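/- Let $d\in\{2,3\}$, let $D\subset\mathbb{R}^d$ be a bounded domain with $C^2$ boundary, let $\tau>0$, and let $a\in L^\infty(\mathbb{R}^d)$ be real-valued, periodic with period cell $Y=[0,1]^d$, with $a(y)\ge a_0>0$ for a.e. $y$. Put $\overline{f}=\frac{1}{|Y|}\int_Y f\,dy$ and $\bar a:=\big(\overline{a^{-1}}\big)^{-1}$. Here $H^2_0(D)$ is the closure of $C_c^\infty(D)$ in $H^2(D)$ (equivalently, the functions in $H^2(D)$ with $u=\partial u/\partial\nu=0$ on $\partial D$), with norm $\|u\|_{H^2_0(D)}=\|\Delta u\|_{L^2(D)}$, and $H^2_\sharp(Y)$ is the space of $Y$-periodic functions that are locally in $H^2(\mathbb{R}^d)$. Let $\chi\in H^2_\sharp(Y)$ and $\gamma=(\gamma_1,\dots,\gamma_d)\in H^2_\sharp(Y)^d$ be the cell functions with cell average zero that solve $$\Delta_y\chi=\frac{\bar a}{a}-1,\qquad -\Delta_y\gamma=2\nabla_y\chi .$$ Then there is a constant $C>0$, depending only on $D$, $\tau$ and $a$, such that the following holds for every $0<\epsilon\le 1$. Suppose that $u_\epsilon,u_0\in H^2_0(D)$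 satisfy, with the same right-hand side $h$ and in the sense of distributions in $D$ (so that $h\in H^{-2}(D)$), $$(\Delta+\tau)\,a(x/\epsilon)\,(\Delta+\tau)u_\epsilon+\tau^2u_\epsilon=h,\qquad (\Delta+\tau)\,\bar a\,(\Delta+\tau)u_0+\tau^2u_0=h,$$ and that $u_0\in H^5(D)$. Put $$u^{(2)}(x)=\chi(x/\epsilon)\,(\Delta+\tau)u_0(x),\qquad u^{(3)}(x)=\gamma(x/\epsilon)\cdot\nabla(\Delta+\tau)u_0(x),$$ and for $n=2,3$ let the boundary corrector $\theta^{(n)}_\epsilon\in H^2(D)$ be the solution of $$(\Delta+\tau)\,a(x/\epsilon)\,(\Delta+\tau)\theta^{(n)}_\epsilon+\tau^2\theta^{(n)}_\epsilon=0\ \text{ in } D,\qquad \theta^{(n)}_\epsilon=-\epsilon u^{(n)},\quad \frac{\partial\theta^{(n)}_\epsilon}{\partial\nu}=-\epsilon\frac{\partial u^{(n)}}{\partial\nu}\ \text{ on }\partial D,$$ the boundary conditions meaning that $\theta^{(n)}_\epsilon+\epsilon u^{(n)}\in H^2_0(D)$. Then $u_\epsilon-\big(u_0+\epsilon^2u^{(2)}+\epsilon\theta^{(2)}_\epsilon+\epsilon^3u^{(3)}+\epsilon^2\theta^{(3)}_\epsilon\big)\in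 H^2_0(D)$ and $$\Big\|u_\epsilon-\big(u_0+\epsilon^2u^{(2)}+\epsilon\theta^{(2)}_\epsilon+\epsilon^3u^{(3)}+\epsilon^2\theta^{(3)}_\epsilon\big)\Big\|_{H^2_0(D)}\le C\,\epsilon^2\,\|u_0\|_{H^5(D)} .$$ -/

import Mathlib

open MeasureTheory TopologicalSpace Set
open scoped Distributions Laplacian

noncomputable section

namespace Homog

/-- Euclidean space `ℝᵈ`. -/
abbrev Space (d : ℕ) : Type := EuclideanSpace ℝ (Fin d)

/-- The `i`-th standard unit vector of `ℝᵈ`. -/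
def stdVec {d : ℕ} (i : Fin d) : Space d := EuclideanSpace.single i 1

/-- `D` has `C²` boundary: near each boundary point, `D` is the set where a `C²` function with
non-vanishing differential is negative. -/
def HasC2Boundary {d : ℕ} (D : Opens (Space d)) : Prop :=
  ∀ p ∈ frontier (D : Set (Space d)), ∃ U : Set (Space d), IsOpen U ∧ p ∈ U ∧
    ∃ ρ : Space d → ℝ, ContDiffOn ℝ 2 ρ U ∧ fderiv ℝ ρ p ≠ 0 ∧
      ∀ x ∈ U, (x ∈ D ↔ ρ x < 0)

/-! ### Weak derivatives and Sobolev spaces -/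

/-- `g` is the weak derivative `∂_{w 0} ∂_{w 1} ⋯ ∂_{w (m-1)} f` on the open set `D`. -/
def HasWeakDeriv {d : ℕ} (D : Opens (Space d)) {m : ℕ} (w : Fin m → Fin d)
    (f g : Space d → ℝ) : Prop :=
  LocallyIntegrableOn f D volume ∧ LocallyIntegrableOn g D volume ∧
    ∀ φ : 𝓓(D, ℝ),
      ∫ x in (D : Set (Space d)), f x * iteratedFDeriv ℝ m φ x (fun j => stdVec (w j)) =
        (-1) ^ m * ∫ x in (D : Set (Space d)), g x * φ x

open Classical in
/-- The weak derivative `∂_{w 0} ⋯ ∂_{w (m-1)} f` on `D`, unique up to a null subset of `D`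
(and `0` if there is none). -/
def weakDeriv {d : ℕ} (D : Opens (Space d)) {m : ℕ} (w : Fin m → Fin d)
    (f : Space d → ℝ) : Space d → ℝ :=
  if h : ∃ g, HasWeakDeriv D w f g then h.choose else 0

/-- The weak Laplacian on `D`. -/
def weakLaplacian {d : ℕ} (D : Opens (Space d)) (f : Space d → ℝ) : Space d → ℝ :=
  fun x => ∑ i : Fin d, weakDeriv D ![i, i] f x

/-- `f ∈ Hᵏ(D)`: all weak derivatives of order `0, …, k` exist and lie in `L²(D)`.
The empty word (order `0`) says that `f` itself is in `L²(D)`. -/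
def MemH {d : ℕ} (D : Opens (Space d)) (k : ℕ) (f : Space d → ℝ) : Prop :=
  ∀ m ≤ k, ∀ w : Fin m → Fin d, ∃ g, HasWeakDeriv D w f g ∧
    MemLp g 2 (volume.restrict (D : Set (Space d)))

/-- The norm of `Hᵏ(D)`: `(∑_{m ≤ k} ‖∇ᵐ f‖²_{L²(D)})^{1/2}`. -/
def normH {d : ℕ} (D : Opens (Space d)) (k : ℕ) (f : Space d → ℝ) : ℝ :=
  Real.sqrt (∑ m ∈ Finset.range (k + 1), ∑ w : Fin m → Fin d,
    ∫ x in (D : Set (Space d)), (weakDeriv D w f x) ^ 2)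

/-- `f ∈ H²₀(D)`: `f` is in the closure of `C_c^∞(D)` in `H²(D)`. -/
def MemH20 {d : ℕ} (D : Opens (Space d)) (f : Space d → ℝ) : Prop :=
  MemH D 2 f ∧ ∀ δ > 0, ∃ φ : 𝓓(D, ℝ), normH D 2 (fun x => f x - φ x) < δ

/-- The norm of `H²₀(D)`, from the inner product `(u, v) ↦ (Δu, Δv)_{L²(D)}`. -/
def normH20 {d : ℕ} (D : Opens (Space d)) (f : Space d → ℝ) : ℝ :=
  Real.sqrt (∫ x in (D : Set (Space d)), (weakLaplacian D f x) ^ 2)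

/-! ### Periodic functions and cell functions -/

/-- `f` is periodic with period cell `Y = [0,1]ᵈ`. -/
def IsPeriodic {d : ℕ} (f : Space d → ℝ) : Prop :=
  ∀ (i : Fin d) (y : Space d), f (y + stdVec i) = f y

/-- The unit cell `Y = [0,1]ᵈ`. -/
def unitCell (d : ℕ) : Set (Space d) := {y | ∀ i, y i ∈ Icc (0 : ℝ) 1}

/-- The cell average `|Y|⁻¹ ∫_Y f`. -/
def cellAvg {d : ℕ} (f : Space d → ℝ) : ℝ := ⨍ y in unitCell d, f y

/-- `f` belongs to the periodic Sobolev space `H²_♯(Y)`: it is `Y`-periodic and its weak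
derivatives on `ℝᵈ` up to order two exist and are square integrable over the cell. -/
def MemHper2 {d : ℕ} (f : Space d → ℝ) : Prop :=
  IsPeriodic f ∧ ∀ m ≤ 2, ∀ w : Fin m → Fin d, ∃ g, HasWeakDeriv ⊤ w f g ∧
    MemLp g 2 (volume.restrict (unitCell d))

/-- The homogenized coefficient: the harmonic mean of `a` over the cell. -/
def homCoeff {d : ℕ} (a : Space d → ℝ) : ℝ := (cellAvg fun y => (a y)⁻¹)⁻¹

/-- `χ` is the scalar cell function: `χ ∈ H²_♯(Y)` has cell average zero and
`Δχ = ā / a - 1`, where `ā` is the harmonic mean of `a`. -/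
def IsCellChi {d : ℕ} (a χ : Space d → ℝ) : Prop :=
  MemHper2 χ ∧ cellAvg χ = 0 ∧
    ∀ᵐ y : Space d, weakLaplacian ⊤ χ y = homCoeff a / a y - 1

/-- `γ` is the vector cell function: each component is in `H²_♯(Y)` with cell average zero, and
`-Δγ = 2∇χ`. -/
def IsCellGamma {d : ℕ} (χ : Space d → ℝ) (γ : Fin d → Space d → ℝ) : Prop :=
  ∀ i, MemHper2 (γ i) ∧ cellAvg (γ i) = 0 ∧
    ∀ᵐ y : Space d, -weakLaplacian ⊤ (γ i) y = 2 * weakDeriv ⊤ ![i] χ y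

/-! ### The fourth-order problem, bulk correctors and boundary correctors -/

/-- `(Δ + τ) u`, with weak derivatives on `D`. -/
def shiftedLaplacian {d : ℕ} (D : Opens (Space d)) (τ : ℝ) (u : Space d → ℝ) : Space d → ℝ :=
  fun x => weakLaplacian D u x + τ * u x

/-- The oscillating function `x ↦ f (x / ε)`. -/
def osc {d : ℕ} (ε : ℝ) (f : Space d → ℝ) : Space d → ℝ := fun x => f (ε⁻¹ • x)

/-- `u ∈ H²(D)` satisfies `(Δ + τ) b (Δ + τ) u + τ² u = h` in `D` in the sense of distributions.
(As `u ∈ H²(D)`, for bounded `b` such an `h` is automatically in `H⁻²(D)`.) -/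
def IsWeakSol {d : ℕ} (D : Opens (Space d)) (τ : ℝ) (b : Space d → ℝ) (h : 𝓓'(D, ℝ))
    (u : Space d → ℝ) : Prop :=
  MemH D 2 u ∧ ∀ φ : 𝓓(D, ℝ),
    (∫ x in (D : Set (Space d)),
        b x * shiftedLaplacian D τ u x * ((Δ (φ : Space d → ℝ)) x + τ * φ x)) +
      τ ^ 2 * (∫ x in (D : Set (Space d)), u x * φ x) = h φ

/-- The bulk corrector `u⁽²⁾(x) = χ(x/ε) (Δ + τ)u₀(x)`. -/
def bulk2 {d : ℕ} (D : Opens (Space d)) (τ ε : ℝ) (χ u₀ : Space d → ℝ) : Space d → ℝ :=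
  fun x => osc ε χ x * shiftedLaplacian D τ u₀ x

/-- The bulk corrector `u⁽³⁾(x) = γ(x/ε) · ∇(Δ + τ)u₀(x)`. -/
def bulk3 {d : ℕ} (D : Opens (Space d)) (τ ε : ℝ) (γ : Fin d → Space d → ℝ)
    (u₀ : Space d → ℝ) : Space d → ℝ :=
  fun x => ∑ i : Fin d, osc ε (γ i) x * weakDeriv D ![i] (shiftedLaplacian D τ u₀) x

/-- `θ ∈ H²(D)` is the boundary corrector for the bulk corrector `v`:
`(Δ + τ) a(x/ε) (Δ + τ) θ + τ² θ = 0` in `D`, with `θ = -ε v` and `∂θ/∂ν = -ε ∂v/∂ν` on `∂D`,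
that is, `θ + ε v ∈ H²₀(D)`. -/
def IsBoundaryCorrector {d : ℕ} (D : Opens (Space d)) (τ ε : ℝ) (a v θ : Space d → ℝ) : Prop :=
  IsWeakSol D τ (osc ε a) 0 θ ∧ MemH20 D (fun x => θ x + ε * v x)

end Homog

end

/-! Write L = Δ + τ and g = L u₀, and let r be the remainder. Grouping r as u_ε - u₀ - ε(θ⁽²⁾ +
εu⁽²⁾) - ε²(θ⁽³⁾ + εu⁽³⁾) shows that r lies in H²₀(D). The boundary correctors solve the homogeneous
equation, so they repair the boundary values and contribute nothing to the weak equation.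

In the bulk, L applied to χ(x/ε) g and to γ(x/ε)·∇g is expanded in powers of ε. Since a(1 + Δχ) = ā,
the terms of order 1 turn a g into ā g. Since Δγ = -2∇χ, the terms of order ε cancel. What is left
is -ε² a(x/ε) times `residual`, which contains derivatives of g up to order three, hence of u₀ up to
order five (`expansion_cancel`). Subtracting the equations for u_ε and u₀ eliminates h, so r
satisfies a weak equation whose data are an L² function R paired with Lφ and an L² function S paired
with φ, both of size ε² (`energy_identity_remainder`). Testing with r itself, by density of test
functions in H²₀(D), gives the bound: the form ∫ a(Lr)² + τ²∫ r² controls Lr and r, hence Δr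
(`energy_estimate`).

The constant is uniform in ε because χ, γ and ∇γ are bounded (`exists_cell_bound`). This is proved
through Fourier coefficients. For f in H²_♯(Y) the coefficients are square summable against |k|⁴,
and the sum of |k|⁻⁴ over nonzero k converges when d < 4, so they are absolutely summable. For ∇γ,
the cell equation makes the coefficients of ∂_jγ_i those of χ times a bounded multiplier.

The expansion needs a product rule for a periodic H² function times an H²(D) function
(`hasWeakDeriv_osc_mul`). The periodic factor is replaced by its Fourier partial sums, which are
smooth and whose derivatives are the partial sums of the weak derivatives; then the limit is taken
in the weak formulation. -/

noncomputable section
namespace Homog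

open scoped LineDeriv

/-! ### The `L²` norm as a real number -/

section L2

variable {α : Type*} [MeasurableSpace α] {μ : Measure α}

/-- The `L²` norm of a real function. -/
def l2norm (μ : Measure α) (f : α → ℝ) : ℝ := (eLpNorm f 2 μ).toReal

lemma l2norm_nonneg (f : α → ℝ) : 0 ≤ l2norm μ f := ENNReal.toReal_nonneg

lemma l2norm_congr {f g : α → ℝ} (h : f =ᵐ[μ] g) : l2norm μ f = l2norm μ g := by
  rw [l2norm, l2norm, eLpNorm_congr_ae h]

lemma l2norm_add_le {f g : α → ℝ} (hf : MemLp f 2 μ) (hg : MemLp g 2 μ) :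
    l2norm μ (f + g) ≤ l2norm μ f + l2norm μ g := by
  rw [l2norm, l2norm, l2norm, ← ENNReal.toReal_add hf.2.ne hg.2.ne]
  exact ENNReal.toReal_mono (by simp [hf.2.ne, hg.2.ne]) (eLpNorm_add_le hf.1 hg.1 (by norm_num))

lemma l2norm_const_mul (c : ℝ) (f : α → ℝ) :
    l2norm μ (fun x => c * f x) = |c| * l2norm μ f := by
  have : (fun x => c * f x) = c • f := rfl
  rw [l2norm, this, eLpNorm_const_smul, ENNReal.toReal_mul]
  simp [l2norm]

lemma l2norm_neg (f : α → ℝ) : l2norm μ (fun x => - f x) = l2norm μ f := by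
  have : (fun x => - f x) = -f := rfl
  rw [l2norm, this, eLpNorm_neg]; rfl

lemma l2norm_sub_le {f g : α → ℝ} (hf : MemLp f 2 μ) (hg : MemLp g 2 μ) :
    l2norm μ (f - g) ≤ l2norm μ f + l2norm μ g := by
  rw [sub_eq_add_neg]
  refine (l2norm_add_le hf hg.neg).trans_eq ?_
  congr 1
  exact l2norm_neg g

lemma l2norm_sum_le {ι : Type*} (s : Finset ι) {f : ι → α → ℝ} (hf : ∀ i ∈ s, MemLp (f i) 2 μ) :
    l2norm μ (fun x => ∑ i ∈ s, f i x) ≤ ∑ i ∈ s, l2norm μ (f i) := by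
  classical
  induction s using Finset.induction_on with
  | empty => simp [l2norm]
  | insert i s hi ih =>
    have hs : ∀ j ∈ s, MemLp (f j) 2 μ := fun j hj => hf j (Finset.mem_insert_of_mem hj)
    simp only [Finset.sum_insert hi]
    refine (l2norm_add_le (hf i (Finset.mem_insert_self i s)) (memLp_finsetSum s hs)).trans ?_
    gcongr
    exact ih hs

lemma l2norm_mul_le {f g : α → ℝ} {M : ℝ} (hM : 0 ≤ M) (hb : ∀ᵐ x ∂μ, |f x| ≤ M)
    (hg : MemLp g 2 μ) : l2norm μ (fun x => f x * g x) ≤ M * l2norm μ g := by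
  rw [l2norm, l2norm, ← ENNReal.toReal_ofReal hM, ← ENNReal.toReal_mul]
  refine ENNReal.toReal_mono (ENNReal.mul_ne_top (by simp) hg.2.ne) ?_
  refine eLpNorm_le_mul_eLpNorm_of_ae_le_mul ?_ 2
  filter_upwards [hb] with x hx
  rw [norm_mul]
  exact mul_le_mul_of_nonneg_right hx (norm_nonneg _)

lemma memLp_bdd_mul {f g : α → ℝ} {M : ℝ} (hf : AEStronglyMeasurable f μ)
    (hb : ∀ᵐ x ∂μ, |f x| ≤ M) (hg : MemLp g 2 μ) : MemLp (fun x => f x * g x) 2 μ := by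
  refine MemLp.of_le_mul (c := M) hg (hf.mul hg.1) ?_
  filter_upwards [hb] with x hx
  rw [norm_mul]
  exact mul_le_mul_of_nonneg_right hx (norm_nonneg _)

lemma integral_sq_eq_l2norm_sq {f : α → ℝ} (hf : MemLp f 2 μ) :
    ∫ x, f x ^ 2 ∂μ = l2norm μ f ^ 2 := by
  have h := hf.eLpNorm_eq_integral_rpow_norm (by norm_num) (by norm_num)
  have h0 : 0 ≤ ∫ x, f x ^ 2 ∂μ := integral_nonneg fun x => sq_nonneg _
  rw [l2norm, h, ENNReal.toReal_ofReal (by positivity)]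
  have : ∀ x, ‖f x‖ ^ (2 : ENNReal).toReal = f x ^ 2 := fun x => by simp
  simp only [this]
  rw [← Real.rpow_natCast, ← Real.rpow_mul h0]
  simp

lemma abs_integral_mul_le_l2norm {f g : α → ℝ} (hf : MemLp f 2 μ) (hg : MemLp g 2 μ) :
    |∫ x, f x * g x ∂μ| ≤ l2norm μ f * l2norm μ g := by
  have h := abs_real_inner_le_norm (hg.toLp g) (hf.toLp f)
  rw [L2.inner_def, Lp.norm_toLp, Lp.norm_toLp] at h
  rw [mul_comm (l2norm μ f), l2norm, l2norm]
  convert h using 2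
  refine integral_congr_ae ?_
  filter_upwards [hf.coeFn_toLp, hg.coeFn_toLp] with x h1 h2
  simp [h1, h2]

lemma integrable_mul_of_memLp_two {f g : α → ℝ} (hf : MemLp f 2 μ) (hg : MemLp g 2 μ) :
    Integrable (fun x => f x * g x) μ :=
  hf.integrable_mul hg

end L2

/-! ### Test functions -/

variable {d : ℕ} {D : Opens (Space d)}

lemma lineDeriv_apply (φ : 𝓓(D, ℝ)) (v x : Space d) : (∂_{v} φ) x = fderiv ℝ φ x v := by
  rw [TestFunction.lineDerivOp_eq_lineDerivCLM ℝ, TestFunction.lineDerivCLM_eq_fderivCLM]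
  simp

/-- Lets every derivative of a test function be treated as a test function again, so that words of
derivatives can be manipulated one letter at a time. -/
lemma iteratedFDeriv_apply (φ : 𝓓(D, ℝ)) {m : ℕ} (v : Fin m → Space d) (x : Space d) :
    iteratedFDeriv ℝ m φ x v = (∂^{v} φ) x := by
  induction m generalizing x with
  | zero => simp
  | succ n ih =>
    rw [LineDeriv.iteratedLineDerivOp_succ_left, iteratedFDeriv_succ_apply_left,
      ← fderiv_continuousMultilinear_apply_const_apply]
    · simp only [lineDeriv_apply]
      congr 2
      ext y
      exact ih _ _
    · exact φ.contDiff.differentiable_iteratedFDeriv (mod_cast ENat.natCast_lt_top n) x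

/-- The derivative `∂_{w 0} ⋯ ∂_{w (m-1)} φ` of a test function. -/
def testDeriv {m : ℕ} (w : Fin m → Fin d) (φ : 𝓓(D, ℝ)) : 𝓓(D, ℝ) :=
  ∂^{fun j => stdVec (w j)} φ

/-- The Laplacian of a test function. -/
def testLap (φ : 𝓓(D, ℝ)) : 𝓓(D, ℝ) := ∑ i, testDeriv ![i, i] φ

lemma testDeriv_one (i : Fin d) (φ : 𝓓(D, ℝ)) : testDeriv ![i] φ = ∂_{stdVec i} φ := rfl

lemma testDeriv_cons (i : Fin d) {m : ℕ} (w : Fin m → Fin d) (φ : 𝓓(D, ℝ)) :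
    testDeriv (Fin.cons i w) φ = testDeriv ![i] (testDeriv w φ) := rfl

lemma testDeriv_zero (w : Fin 0 → Fin d) (φ : 𝓓(D, ℝ)) : testDeriv w φ = φ := rfl

lemma sum_test_apply {ι : Type*} (s : Finset ι) (φ : ι → 𝓓(D, ℝ)) (x : Space d) :
    (∑ i ∈ s, φ i) x = ∑ i ∈ s, φ i x := by
  classical
  induction s using Finset.induction_on with
  | empty => simp
  | insert i s hi ih => simp [Finset.sum_insert hi, ih]

lemma testLap_apply (φ : 𝓓(D, ℝ)) (x : Space d) :
    testLap φ x = ∑ i, testDeriv ![i, i] φ x := sum_test_apply _ _ x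

lemma laplacian_eq_testLap (φ : 𝓓(D, ℝ)) (x : Space d) :
    (Δ (φ : Space d → ℝ)) x = testLap φ x := by
  rw [InnerProductSpace.laplacian_eq_iteratedFDeriv_orthonormalBasis _
    (EuclideanSpace.basisFun (Fin d) ℝ), testLap_apply]
  refine Finset.sum_congr rfl fun i _ => ?_
  rw [iteratedFDeriv_apply, testDeriv]
  congr 2
  ext j : 1
  fin_cases j <;> simp [stdVec]

/-- The product of a smooth function and a test function. -/
def smoothMul (p : Space d → ℝ) (hp : ContDiff ℝ (⊤ : ℕ∞) p) (φ : 𝓓(D, ℝ)) : 𝓓(D, ℝ) where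
  toFun x := p x * φ x
  contDiff' := by
    have := φ.contDiff
    exact hp.mul this
  hasCompactSupport' := φ.hasCompactSupport.mul_left
  tsupport_subset' := (tsupport_mul_subset_right).trans φ.tsupport_subset

@[simp] lemma smoothMul_apply (p : Space d → ℝ) (hp : ContDiff ℝ (⊤ : ℕ∞) p) (φ : 𝓓(D, ℝ))
    (x : Space d) : smoothMul p hp φ x = p x * φ x := rfl

lemma test_differentiable (φ : 𝓓(D, ℝ)) : Differentiable ℝ φ :=
  φ.contDiff.differentiable (by simp)

lemma testDeriv_smoothMul (p : Space d → ℝ) (hp : ContDiff ℝ (⊤ : ℕ∞) p) (φ : 𝓓(D, ℝ)) (i : Fin d)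
    (x : Space d) : testDeriv ![i] (smoothMul p hp φ) x =
      p x * testDeriv ![i] φ x + fderiv ℝ p x (stdVec i) * φ x := by
  rw [testDeriv_one, testDeriv_one, lineDeriv_apply, lineDeriv_apply]
  have h1 : DifferentiableAt ℝ p x := (hp.differentiable (by simp)) x
  have : (smoothMul p hp φ : Space d → ℝ) = fun x => p x * φ x := rfl
  rw [this, fderiv_fun_mul h1 (test_differentiable φ x)]
  simp [mul_comm]

/-! ### Integrals against test functions -/

lemma integrable_mul_test {f : Space d → ℝ} (hf : LocallyIntegrableOn f D volume)
    (φ : 𝓓(D, ℝ)) : Integrable (fun x => f x * φ x) (volume.restrict (D : Set (Space d))) := by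
  have := φ.integrable_bilin (ContinuousLinearMap.mul ℝ ℝ) hf
  refine (this.congr (ae_of_all _ fun x => ?_)).restrict
  simp [mul_comm]

lemma locallyIntegrableOn_of_memLp {f : Space d → ℝ}
    (hf : MemLp f 2 (volume.restrict (D : Set (Space d)))) : LocallyIntegrableOn f D volume := by
  have := (hf.locallyIntegrable (by norm_num))
  intro x hx
  obtain ⟨U, hU, hUf⟩ := this x
  refine ⟨U ∩ D, Filter.inter_mem (mem_nhdsWithin_of_mem_nhds hU) self_mem_nhdsWithin, ?_⟩
  rw [IntegrableOn, Measure.restrict_restrict' D.isOpen.measurableSet] at hUf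
  exact hUf

lemma memLp_test (φ : 𝓓(D, ℝ)) : MemLp φ 2 (volume.restrict (D : Set (Space d))) :=
  φ.continuous.memLp_of_hasCompactSupport φ.hasCompactSupport

lemma locallyIntegrableOn_test (φ : 𝓓(D, ℝ)) : LocallyIntegrableOn φ D volume :=
  locallyIntegrableOn_of_memLp (memLp_test φ)

/-- Locally integrable functions with the same integrals against all test functions agree. -/
lemma ae_eq_of_forall_test {f g : Space d → ℝ} (hf : LocallyIntegrableOn f D volume)
    (hg : LocallyIntegrableOn g D volume)
    (h : ∀ φ : 𝓓(D, ℝ), ∫ x in (D : Set (Space d)), f x * φ x =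
      ∫ x in (D : Set (Space d)), g x * φ x) :
    f =ᵐ[volume.restrict (D : Set (Space d))] g := by
  have key := D.isOpen.ae_eq_zero_of_integral_contDiff_smul_eq_zero (hf.sub hg) (μ := volume) ?_
  · rw [Filter.EventuallyEq, ae_restrict_iff' D.isOpen.measurableSet]
    filter_upwards [key] with x hx hxD
    exact sub_eq_zero.1 (hx hxD)
  · intro ψ h1 h2 h3
    let φ : 𝓓(D, ℝ) := ⟨ψ, h1, h2, h3⟩
    have e := h φ
    rw [← sub_eq_zero, ← integral_sub (integrable_mul_test hf φ) (integrable_mul_test hg φ)] at e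
    rw [← setIntegral_eq_integral_of_forall_compl_eq_zero (s := (D : Set (Space d)))]
    · rw [← e]
      refine integral_congr_ae (ae_of_all _ fun x => ?_)
      change ψ x * (f x - g x) = f x * ψ x - g x * ψ x
      ring
    · intro x hx
      have : ψ x = 0 := image_eq_zero_of_notMem_tsupport fun hx' => hx (h3 hx')
      simp [this]

lemma integral_testDeriv_mul (φ ψ : 𝓓(D, ℝ)) (i : Fin d) :
    ∫ x in (D : Set (Space d)), φ x * testDeriv ![i] ψ x =
      - ∫ x in (D : Set (Space d)), testDeriv ![i] φ x * ψ x := by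
  have h1 : ∀ φ ψ : 𝓓(D, ℝ), ∫ x in (D : Set (Space d)), φ x * ψ x = ∫ x, φ x * ψ x := by
    intro φ ψ
    refine setIntegral_eq_integral_of_forall_compl_eq_zero fun x hx => ?_
    have : φ x = 0 := image_eq_zero_of_notMem_tsupport fun hx' => hx (φ.tsupport_subset hx')
    simp [this]
  have h2 : ∀ φ ψ : 𝓓(D, ℝ), Integrable (fun x => φ x * ψ x) := fun φ ψ =>
    (φ.continuous.mul ψ.continuous).integrable_of_hasCompactSupport φ.hasCompactSupport.mul_right
  rw [h1, h1]
  have h3 := h2 (testDeriv ![i] φ) ψ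
  have h4 := h2 φ (testDeriv ![i] ψ)
  simp only [testDeriv_one, lineDeriv_apply] at h3 h4 ⊢
  exact integral_mul_fderiv_eq_neg_fderiv_mul_of_integrable h3 h4 (h2 φ ψ)
    (fun x _ => test_differentiable φ x) (fun x _ => test_differentiable ψ x)

/-! ### Weak derivatives -/

section Weak

variable {m : ℕ} {w : Fin m → Fin d} {f g f' g' : Space d → ℝ}

lemma hasWeakDeriv_iff : HasWeakDeriv D w f g ↔ LocallyIntegrableOn f D volume ∧
    LocallyIntegrableOn g D volume ∧ ∀ φ : 𝓓(D, ℝ),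
      ∫ x in (D : Set (Space d)), f x * testDeriv w φ x =
        (-1) ^ m * ∫ x in (D : Set (Space d)), g x * φ x := by
  simp only [HasWeakDeriv, iteratedFDeriv_apply, testDeriv]

lemma HasWeakDeriv.integral_eq (h : HasWeakDeriv D w f g) (φ : 𝓓(D, ℝ)) :
    ∫ x in (D : Set (Space d)), f x * testDeriv w φ x =
        (-1) ^ m * ∫ x in (D : Set (Space d)), g x * φ x :=
  (hasWeakDeriv_iff.1 h).2.2 φ

lemma HasWeakDeriv.ae_eq (h : HasWeakDeriv D w f g) (h' : HasWeakDeriv D w f g') :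
    g =ᵐ[volume.restrict (D : Set (Space d))] g' := by
  refine ae_eq_of_forall_test h.2.1 h'.2.1 fun φ => ?_
  have := (h.integral_eq φ).symm.trans (h'.integral_eq φ)
  exact mul_left_cancel₀ (pow_ne_zero _ (by norm_num)) this

lemma HasWeakDeriv.hasWeakDeriv_weakDeriv (h : HasWeakDeriv D w f g) :
    HasWeakDeriv D w f (weakDeriv D w f) := by
  have : ∃ g, HasWeakDeriv D w f g := ⟨g, h⟩
  rw [weakDeriv, dif_pos this]
  exact this.choose_spec

lemma HasWeakDeriv.weakDeriv_ae_eq (h : HasWeakDeriv D w f g) :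
    weakDeriv D w f =ᵐ[volume.restrict (D : Set (Space d))] g :=
  h.hasWeakDeriv_weakDeriv.ae_eq h

lemma LocallyIntegrableOn.congr_ae_restrict (h : LocallyIntegrableOn f D volume)
    (e : f =ᵐ[volume.restrict (D : Set (Space d))] f') : LocallyIntegrableOn f' D volume := by
  intro x hx
  obtain ⟨U, hU, hUf⟩ := h x hx
  refine ⟨U ∩ D, Filter.inter_mem hU self_mem_nhdsWithin, ?_⟩
  refine (hUf.mono_set inter_subset_left).congr ?_
  exact ae_restrict_of_ae_restrict_of_subset inter_subset_right e

lemma integral_mul_test_congr (e : f =ᵐ[volume.restrict (D : Set (Space d))] f')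
    (φ : 𝓓(D, ℝ)) : ∫ x in (D : Set (Space d)), f x * φ x =
      ∫ x in (D : Set (Space d)), f' x * φ x := by
  refine integral_congr_ae ?_
  filter_upwards [e] with x hx
  rw [hx]

lemma HasWeakDeriv.congr_ae (h : HasWeakDeriv D w f g)
    (ef : f =ᵐ[volume.restrict (D : Set (Space d))] f')
    (eg : g =ᵐ[volume.restrict (D : Set (Space d))] g') : HasWeakDeriv D w f' g' := by
  refine hasWeakDeriv_iff.2 ⟨LocallyIntegrableOn.congr_ae_restrict h.1 ef,
    LocallyIntegrableOn.congr_ae_restrict h.2.1 eg, fun φ => ?_⟩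
  rw [← integral_mul_test_congr ef, h.integral_eq, integral_mul_test_congr eg]

lemma HasWeakDeriv.add (h : HasWeakDeriv D w f g) (h' : HasWeakDeriv D w f' g') :
    HasWeakDeriv D w (fun x => f x + f' x) (fun x => g x + g' x) := by
  refine hasWeakDeriv_iff.2 ⟨h.1.add h'.1, h.2.1.add h'.2.1, fun φ => ?_⟩
  simp only [add_mul]
  rw [integral_add (integrable_mul_test h.1 _) (integrable_mul_test h'.1 _),
    integral_add (integrable_mul_test h.2.1 _) (integrable_mul_test h'.2.1 _),
    h.integral_eq, h'.integral_eq, mul_add]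

lemma HasWeakDeriv.const_mul (c : ℝ) (h : HasWeakDeriv D w f g) :
    HasWeakDeriv D w (fun x => c * f x) (fun x => c * g x) := by
  refine hasWeakDeriv_iff.2 ⟨?_, ?_, fun φ => ?_⟩
  · exact h.1.smul c
  · exact h.2.1.smul c
  simp only [mul_assoc]
  rw [integral_const_mul, integral_const_mul, h.integral_eq]
  ring

lemma HasWeakDeriv.sum {ι : Type*} (s : Finset ι) {F G : ι → Space d → ℝ}
    (h : ∀ i ∈ s, HasWeakDeriv D w (F i) (G i)) :
    HasWeakDeriv D w (fun x => ∑ i ∈ s, F i x) (fun x => ∑ i ∈ s, G i x) := by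
  classical
  induction s using Finset.induction_on with
  | empty =>
    have h0 : LocallyIntegrableOn (fun _ : Space d => (0 : ℝ)) D volume :=
      (locallyIntegrable_const 0).locallyIntegrableOn _
    refine hasWeakDeriv_iff.2 ⟨by simpa using h0, by simpa using h0, by simp⟩
  | insert i s hi ih =>
    simp only [Finset.sum_insert hi]
    exact (h i (Finset.mem_insert_self i s)).add
      (ih fun j hj => h j (Finset.mem_insert_of_mem hj))

lemma hasWeakDeriv_zero (w : Fin 0 → Fin d) (hf : LocallyIntegrableOn f D volume) :
    HasWeakDeriv D w f f :=
  hasWeakDeriv_iff.2 ⟨hf, hf, fun φ => by simp [testDeriv_zero]⟩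

lemma hasWeakDeriv_test (w : Fin m → Fin d) (φ : 𝓓(D, ℝ)) :
    HasWeakDeriv D w φ (testDeriv w φ) := by
  refine hasWeakDeriv_iff.2
    ⟨locallyIntegrableOn_test φ, locallyIntegrableOn_test _, fun ψ => ?_⟩
  induction m generalizing ψ φ with
  | zero => simp [testDeriv_zero]
  | succ n ih =>
    have e1 : testDeriv w ψ = testDeriv ![w 0] (testDeriv (Fin.tail w) ψ) := rfl
    rw [e1, integral_testDeriv_mul, ih]
    -- Integration by parts moves the outermost letter of the word on ψ to the innermost place on φ.
    -- Symmetry of second derivatives brings it back outside.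
    have e2 : testDeriv (Fin.tail w) (testDeriv ![w 0] φ) = testDeriv w φ := by
      have comm : ∀ (φ : 𝓓(D, ℝ)) (i j : Fin d), testDeriv ![i] (testDeriv ![j] φ) =
          testDeriv ![j] (testDeriv ![i] φ) := by
        intro φ i j
        ext x
        change testDeriv ![i, j] φ x = testDeriv ![j, i] φ x
        rw [testDeriv, ← iteratedFDeriv_apply, testDeriv, ← iteratedFDeriv_apply,
          iteratedFDeriv_two_apply, iteratedFDeriv_two_apply]
        have hs : IsSymmSndFDerivAt ℝ φ x :=
          (φ.contDiff.contDiffAt).isSymmSndFDerivAt (by simp; exact WithTop.coe_le_coe.2 (le_top : (2 : ℕ∞) ≤ ⊤))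
        simpa using hs (stdVec i) (stdVec j)
      have gen : ∀ (k : ℕ) (v : Fin k → Fin d) (i : Fin d) (φ : 𝓓(D, ℝ)),
          testDeriv v (testDeriv ![i] φ) = testDeriv ![i] (testDeriv v φ) := by
        intro k
        induction k with
        | zero => intro v i φ; rfl
        | succ k ihk =>
          intro v i φ
          have e3 : ∀ χ : 𝓓(D, ℝ), testDeriv v χ =
            testDeriv ![v 0] (testDeriv (Fin.tail v) χ) := fun χ => rfl
          rw [e3, e3, ihk, comm]
      rw [gen]; rfl
    rw [e2]
    ring

/-- Removing the first (outermost) letter of a word of derivatives. -/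
lemma HasWeakDeriv.of_cons {i : Fin d} {h : Space d → ℝ} (h1 : HasWeakDeriv D ![i] f g)
    (h2 : HasWeakDeriv D (Fin.cons i w : Fin (m + 1) → Fin d) f h) : HasWeakDeriv D w g h := by
  refine hasWeakDeriv_iff.2 ⟨h1.2.1, h2.2.1, fun φ => ?_⟩
  have e1 := h1.integral_eq (testDeriv w φ)
  have e2 := h2.integral_eq φ
  rw [testDeriv_cons] at e2
  rw [e2] at e1
  rw [pow_succ] at e1
  linarith

end Weak

/-! ### Sobolev functions with a bound on all derivatives -/

/-- The restriction of Lebesgue measure to `D`. -/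
abbrev volOn (D : Opens (Space d)) : Measure (Space d) := volume.restrict (D : Set (Space d))

/-- `f ∈ Hᵏ(D)`, with all weak derivatives of order at most `k` bounded in `L²(D)` by `N`. -/
def MemHB (D : Opens (Space d)) (k : ℕ) (f : Space d → ℝ) (N : ℝ) : Prop :=
  ∀ m ≤ k, ∀ w : Fin m → Fin d, ∃ g, HasWeakDeriv D w f g ∧ MemLp g 2 (volOn D) ∧
    l2norm (volOn D) g ≤ N

section MemHB

variable {k m : ℕ} {f g f' : Space d → ℝ} {N N' : ℝ}

lemma MemHB.weakDeriv (h : MemHB D k f N) (hm : m ≤ k) (w : Fin m → Fin d) :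
    HasWeakDeriv D w f (weakDeriv D w f) ∧ MemLp (Homog.weakDeriv D w f) 2 (volOn D) ∧
      l2norm (volOn D) (Homog.weakDeriv D w f) ≤ N := by
  obtain ⟨g, h1, h2, h3⟩ := h m hm w
  refine ⟨h1.hasWeakDeriv_weakDeriv, (memLp_congr_ae h1.weakDeriv_ae_eq).2 h2, ?_⟩
  rwa [l2norm_congr h1.weakDeriv_ae_eq]

lemma MemH.weakDeriv (h : MemH D k f) (hm : m ≤ k) (w : Fin m → Fin d) :
    HasWeakDeriv D w f (weakDeriv D w f) ∧ MemLp (Homog.weakDeriv D w f) 2 (volOn D) := by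
  obtain ⟨g, h1, h2⟩ := h m hm w
  exact ⟨h1.hasWeakDeriv_weakDeriv, (memLp_congr_ae h1.weakDeriv_ae_eq).2 h2⟩

lemma normH_sq (h : MemH D k f) : normH D k f ^ 2 = ∑ m ∈ Finset.range (k + 1),
    ∑ w : Fin m → Fin d, l2norm (volOn D) (weakDeriv D w f) ^ 2 := by
  rw [normH, Real.sq_sqrt]
  · refine Finset.sum_congr rfl fun m hm => Finset.sum_congr rfl fun w _ => ?_
    exact integral_sq_eq_l2norm_sq (h.weakDeriv (by simpa [Nat.lt_succ_iff] using hm) w).2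
  · exact Finset.sum_nonneg fun m _ => Finset.sum_nonneg fun w _ =>
      integral_nonneg fun x => sq_nonneg _

lemma normH_nonneg : 0 ≤ normH D k f := Real.sqrt_nonneg _

lemma MemH.memHB (h : MemH D k f) : MemHB D k f (normH D k f) := by
  intro m hm w
  obtain ⟨h1, h2⟩ := h.weakDeriv hm w
  refine ⟨_, h1, h2, ?_⟩
  refine abs_le_of_sq_le_sq' ?_ normH_nonneg |>.2
  rw [normH_sq h]
  refine le_trans ?_ (Finset.single_le_sum (f := fun m => ∑ w : Fin m → Fin d,
    l2norm (volOn D) (Homog.weakDeriv D w f) ^ 2) (fun i _ => by positivity)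
    (Finset.mem_range.2 (Nat.lt_succ_of_le hm)))
  exact Finset.single_le_sum (f := fun w : Fin m → Fin d =>
    l2norm (volOn D) (Homog.weakDeriv D w f) ^ 2) (fun i _ => by positivity)
    (Finset.mem_univ w)

lemma MemHB.memH (h : MemHB D k f N) : MemH D k f := fun m hm w => by
  obtain ⟨g, h1, h2, -⟩ := h m hm w
  exact ⟨g, h1, h2⟩

lemma MemHB.mono {k' : ℕ} (h : MemHB D k f N) (hk : k' ≤ k) : MemHB D k' f N :=
  fun m hm w => h m (hm.trans hk) w

lemma MemHB.memLp (h : MemHB D k f N) : MemLp f 2 (volOn D) ∧ l2norm (volOn D) f ≤ N := by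
  obtain ⟨g, h1, h2, h3⟩ := h 0 (Nat.zero_le _) ![]
  have e := h1.ae_eq (hasWeakDeriv_zero _ h1.1)
  exact ⟨(memLp_congr_ae e).1 h2, by rwa [← l2norm_congr e]⟩

lemma MemH.memLp (h : MemH D k f) : MemLp f 2 (volOn D) := h.memHB.memLp.1

lemma MemHB.congr_ae (h : MemHB D k f N) (e : f =ᵐ[volOn D] f') : MemHB D k f' N := by
  intro m hm w
  obtain ⟨g, h1, h2, h3⟩ := h m hm w
  exact ⟨g, h1.congr_ae e (ae_eq_refl g), h2, h3⟩

lemma MemHB.add (h : MemHB D k f N) (h' : MemHB D k f' N') :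
    MemHB D k (fun x => f x + f' x) (N + N') := by
  intro m hm w
  obtain ⟨g, h1, h2, h3⟩ := h m hm w
  obtain ⟨g', h1', h2', h3'⟩ := h' m hm w
  exact ⟨_, h1.add h1', h2.add h2', (l2norm_add_le h2 h2').trans (add_le_add h3 h3')⟩

lemma MemHB.const_mul (c : ℝ) (h : MemHB D k f N) :
    MemHB D k (fun x => c * f x) (|c| * N) := by
  intro m hm w
  obtain ⟨g, h1, h2, h3⟩ := h m hm w
  refine ⟨_, h1.const_mul c, h2.const_mul c, ?_⟩
  rw [l2norm_const_mul]
  gcongr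

lemma MemHB.sum {ι : Type*} (s : Finset ι) {F : ι → Space d → ℝ}
    (h : ∀ i ∈ s, MemHB D k (F i) N) : MemHB D k (fun x => ∑ i ∈ s, F i x) (s.card * N) := by
  intro m hm w
  refine ⟨fun x => ∑ i ∈ s, Homog.weakDeriv D w (F i) x,
    HasWeakDeriv.sum s fun i hi => ((h i hi).weakDeriv hm w).1,
    memLp_finsetSum s fun i hi => ((h i hi).weakDeriv hm w).2.1, ?_⟩
  refine (l2norm_sum_le s fun i hi => ((h i hi).weakDeriv hm w).2.1).trans ?_
  refine (Finset.sum_le_sum fun i hi => ((h i hi).weakDeriv hm w).2.2).trans ?_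
  simp

lemma MemH.add (h : MemH D k f) (h' : MemH D k f') : MemH D k (fun x => f x + f' x) :=
  (h.memHB.add h'.memHB).memH

lemma MemH.const_mul (c : ℝ) (h : MemH D k f) : MemH D k (fun x => c * f x) :=
  (h.memHB.const_mul c).memH

lemma memH_test (φ : 𝓓(D, ℝ)) : MemH D k φ := fun _ _ w =>
  ⟨testDeriv w φ, hasWeakDeriv_test w φ, memLp_test _⟩

/-- The first weak derivatives of a function in `Hᵏ⁺¹(D)` belong to `Hᵏ(D)`. -/
lemma MemHB.deriv (h : MemHB D (k + 1) f N) (i : Fin d) :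
    MemHB D k (Homog.weakDeriv D ![i] f) N := by
  intro m hm w
  obtain ⟨g, h1, h2, h3⟩ := h (m + 1) (by omega) (Fin.cons i w)
  exact ⟨g, (h.weakDeriv (by omega) ![i]).1.of_cons h1, h2, h3⟩

lemma MemHB.weakDeriv_weakDeriv (h : MemHB D (k + 2) f N) (i j : Fin d) :
    HasWeakDeriv D ![j] (Homog.weakDeriv D ![i] f) (Homog.weakDeriv D ![i, j] f) := by
  have h1 := (h.weakDeriv (by omega : 1 ≤ k + 2) ![i]).1
  have h2 := (h.weakDeriv (by omega : 2 ≤ k + 2) ![i, j]).1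
  exact h1.of_cons h2

/-- Weak derivatives are chosen representatives, so the derivative of a derivative and the
derivative along a word of length two agree only almost everywhere. Membership is therefore
transported along an a.e. equality. -/
lemma MemHB.deriv₂ (h : MemHB D (k + 2) f N) (i j : Fin d) :
    MemHB D k (Homog.weakDeriv D ![i, j] f) N :=
  ((h.deriv (k := k + 1) i).deriv j).congr_ae (h.weakDeriv_weakDeriv i j).weakDeriv_ae_eq

lemma MemHB.laplacian (h : MemHB D (k + 2) f N) : MemHB D k (weakLaplacian D f) (d * N) := by
  have := MemHB.sum Finset.univ fun i (_ : i ∈ Finset.univ) => h.deriv₂ i i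
  rwa [Finset.card_univ, Fintype.card_fin] at this

lemma MemHB.shiftedLaplacian {τ : ℝ} (hτ : 0 ≤ τ) (h : MemHB D (k + 2) f N) :
    MemHB D k (shiftedLaplacian D τ f) ((d + τ) * N) := by
  have := h.laplacian.add ((h.mono (Nat.le_add_right k 2)).const_mul τ)
  rw [abs_of_nonneg hτ, ← add_mul] at this
  exact this

end MemHB


/-! ### Fourier series on the unit cell -/

section Fourier

variable {d : ℕ}

/-- The half-open unit cell. -/
def cube (d : ℕ) : Set (Space d) := {y | ∀ i, y i ∈ Ioc (0 : ℝ) 1}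

lemma cube_eq_preimage (d : ℕ) :
    cube d = (WithLp.ofLp : Space d → Fin d → ℝ) ⁻¹' (Set.univ.pi fun _ => Ioc (0 : ℝ) 1) := by
  ext y; simp [cube]

lemma measurableSet_cube : MeasurableSet (cube d) := by
  rw [cube_eq_preimage]
  exact (PiLp.volume_preserving_ofLp (Fin d)).measurable
    (MeasurableSet.univ_pi fun _ => measurableSet_Ioc)

/-- The faces are null. The half-open cell is preferred because its integer translates partition the
space and it is a fundamental domain for the torus. -/
lemma restrict_unitCell : volume.restrict (unitCell d) = volume.restrict (cube d) := by
  refine Measure.restrict_congr_set ?_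
  have h : unitCell d =
      (WithLp.ofLp : Space d → Fin d → ℝ) ⁻¹' (Icc (fun _ => 0) (fun _ => 1)) := by
    ext y; simp [unitCell, Pi.le_def, forall_and]
  rw [h, cube_eq_preimage]
  refine (PiLp.volume_preserving_ofLp (Fin d)).quasiMeasurePreserving.preimage_ae_eq ?_
  have := (Measure.univ_pi_Ioc_ae_eq_Icc (ι := Fin d) (μ := fun _ => (volume : Measure ℝ))
    (f := fun _ => 0) (g := fun _ => 1)).symm
  exact this

lemma volume_cube : volume (cube d) = 1 := by
  rw [cube_eq_preimage, (PiLp.volume_preserving_ofLp (Fin d)).measure_preimage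
    (MeasurableSet.univ_pi fun _ => measurableSet_Ioc).nullMeasurableSet]
  rw [volume_pi_pi]; simp

instance : IsFiniteMeasure (volume.restrict (cube d)) := ⟨by simp [volume_cube]⟩

/-- Lebesgue measure on the half-open unit cell. -/
abbrev volCube (d : ℕ) : Measure (Space d) := volume.restrict (cube d)

/-- The phase `2π k · y`. -/
def phase (k : Fin d → ℤ) (y : Space d) : ℝ := 2 * Real.pi * ∑ i, (k i : ℝ) * y i

/-- The cosine coefficient `∫_Y F cos (2π k · y)`. -/
def cosCoeff (F : Space d → ℝ) (k : Fin d → ℤ) : ℝ :=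
  ∫ y in cube d, F y * Real.cos (phase k y)

/-- The sine coefficient `∫_Y F sin (2π k · y)`. -/
def sinCoeff (F : Space d → ℝ) (k : Fin d → ℤ) : ℝ :=
  ∫ y in cube d, F y * Real.sin (phase k y)

/-- The partial sum of the Fourier series of `F` over a finite set of frequencies. -/
def fourierSum (S : Finset (Fin d → ℤ)) (F : Space d → ℝ) (y : Space d) : ℝ :=
  ∑ k ∈ S, (cosCoeff F k * Real.cos (phase k y) + sinCoeff F k * Real.sin (phase k y))

@[fun_prop] lemma continuous_phase (k : Fin d → ℤ) : Continuous (phase k) := by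
  unfold phase; fun_prop

-- Transfer of L² Fourier theory from the torus to the cell.

local instance : MeasureSpace UnitAddCircle := ⟨AddCircle.haarAddCircle⟩

local instance : Measure.IsAddHaarMeasure (volume : Measure UnitAddCircle) :=
  inferInstanceAs (Measure.IsAddHaarMeasure AddCircle.haarAddCircle)

local instance : IsProbabilityMeasure (volume : Measure UnitAddCircle) :=
  inferInstanceAs (IsProbabilityMeasure AddCircle.haarAddCircle)

/-- The projection of `ℝᵈ` to the torus. -/
def toTorus (y : Space d) : UnitAddTorus (Fin d) := fun i => (y i : UnitAddCircle)

/-- The section of the projection to the torus with values in the half-open unit cell. -/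
def ofTorus (t : UnitAddTorus (Fin d)) : Space d :=
  WithLp.toLp 2 (UnitAddTorus.measurableEquivPiIoc (fun _ => (0 : ℝ)) t).1

lemma measurable_toTorus : Measurable (toTorus : Space d → UnitAddTorus (Fin d)) := by
  refine measurable_pi_lambda _ fun i => ?_
  exact AddCircle.measurable_mk'.comp (by fun_prop)

lemma measurable_ofTorus : Measurable (ofTorus : UnitAddTorus (Fin d) → Space d) := by
  refine (PiLp.volume_preserving_toLp (Fin d)).measurable.comp ?_
  exact measurable_subtype_coe.comp (UnitAddTorus.measurableEquivPiIoc (fun _ => (0 : ℝ))).measurable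

lemma ofTorus_toTorus {y : Space d} (hy : y ∈ cube d) : ofTorus (toTorus y) = y := by
  ext i
  simp only [ofTorus, toTorus, UnitAddTorus.coe_measurableEquivPiIoc_apply]
  have h : y i ∈ Ioc (0 : ℝ) (0 + 1) := by simpa using hy i
  rw [AddCircle.equivIoc_coe_of_mem (p := 1) (a := 0) h]

lemma measurePreserving_toTorus :
    MeasurePreserving (toTorus : Space d → UnitAddTorus (Fin d)) (volCube d) volume := by
  refine ⟨measurable_toTorus, ?_⟩
  ext s hs
  rw [Measure.map_apply measurable_toTorus hs]
  have h := UnitAddTorus.lintegral_preimage (s.indicator 1) (fun _ : Fin d => (0 : ℝ))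
  rw [lintegral_indicator_one hs] at h
  rw [h]
  have hset : {x : Fin d → ℝ | ∀ i, x i ∈ Ioc (0 : ℝ) (0 + 1)} =
      Set.univ.pi fun _ => Ioc (0 : ℝ) 1 := by ext; simp
  rw [hset]
  rw [← (((PiLp.volume_preserving_ofLp (Fin d)).restrict_preimage
    (MeasurableSet.univ_pi fun _ => measurableSet_Ioc (a := (0 : ℝ)) (b := 1))).lintegral_comp_emb
    (MeasurableEquiv.toLp 2 (Fin d → ℝ)).symm.measurableEmbedding)]
  rw [← cube_eq_preimage, ← lintegral_indicator_one (measurable_toTorus hs)]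
  rfl

lemma measurePreserving_ofTorus :
    MeasurePreserving (ofTorus : UnitAddTorus (Fin d) → Space d) volume (volCube d) := by
  refine ⟨measurable_ofTorus, ?_⟩
  rw [← measurePreserving_toTorus.map_eq, Measure.map_map measurable_ofTorus measurable_toTorus]
  conv_rhs => rw [← Measure.map_id (μ := volCube d)]
  refine Measure.map_congr ?_
  filter_upwards [ae_restrict_mem measurableSet_cube] with y hy
  exact ofTorus_toTorus hy

lemma mFourier_toTorus (k : Fin d → ℤ) (y : Space d) :
    UnitAddTorus.mFourier k (toTorus y) =
      (Real.cos (phase k y) : ℂ) + Real.sin (phase k y) * Complex.I := by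
  simp only [UnitAddTorus.mFourier, toTorus, ContinuousMap.coe_mk, fourier_coe_apply]
  rw [← Complex.exp_sum, Complex.ofReal_cos, Complex.ofReal_sin, ← Complex.exp_mul_I]
  congr 1
  simp only [phase, Complex.ofReal_mul, Complex.ofReal_sum, Finset.mul_sum, Finset.sum_mul]
  refine Finset.sum_congr rfl fun i _ => ?_
  push_cast
  ring

/-- A real function on the unit cell as a complex function on the torus. -/
def onTorus (F : Space d → ℝ) (t : UnitAddTorus (Fin d)) : ℂ := (F (ofTorus t) : ℂ)

variable {F : Space d → ℝ}

lemma memLp_onTorus (hF : MemLp F 2 (volCube d)) : MemLp (onTorus F) 2 volume :=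
  (hF.comp_measurePreserving measurePreserving_ofTorus).ofReal

lemma integrable_mul_cos (hF : Integrable F (volCube d)) (k : Fin d → ℤ) :
    Integrable (fun y => F y * Real.cos (phase k y)) (volCube d) := by
  refine hF.mul_bdd (c := 1) (by fun_prop) (ae_of_all _ fun y => ?_)
  exact Real.abs_cos_le_one _

lemma integrable_mul_sin (hF : Integrable F (volCube d)) (k : Fin d → ℤ) :
    Integrable (fun y => F y * Real.sin (phase k y)) (volCube d) := by
  refine hF.mul_bdd (c := 1) (by fun_prop) (ae_of_all _ fun y => ?_)
  exact Real.abs_sin_le_one _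

lemma phase_neg (k : Fin d → ℤ) (y : Space d) : phase (-k) y = - phase k y := by
  simp [phase]

lemma mFourierCoeff_onTorus (hF : MemLp F 2 (volCube d)) (k : Fin d → ℤ) :
    UnitAddTorus.mFourierCoeff (onTorus F) k = cosCoeff F k - sinCoeff F k * Complex.I := by
  have hFi : Integrable F (volCube d) := hF.integrable (by norm_num)
  have hm : AEStronglyMeasurable (fun t => UnitAddTorus.mFourier (-k) t • onTorus F t)
      (volume : Measure (UnitAddTorus (Fin d))) :=
    (UnitAddTorus.mFourier (-k)).continuous.aestronglyMeasurable.smul (memLp_onTorus hF).1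
  rw [UnitAddTorus.mFourierCoeff, ← measurePreserving_toTorus.map_eq,
    integral_map measurable_toTorus.aemeasurable
      (by rwa [measurePreserving_toTorus.map_eq]), cosCoeff, sinCoeff,
      ← integral_complex_ofReal, ← integral_complex_ofReal, ← integral_mul_const, ← integral_sub]
  · refine integral_congr_ae ?_
    filter_upwards [ae_restrict_mem measurableSet_cube] with y hy
    rw [onTorus, ofTorus_toTorus hy, mFourier_toTorus, phase_neg]
    simp
    ring
  · exact (integrable_mul_cos hFi k).ofReal
  · exact (integrable_mul_sin hFi k).ofReal.mul_const _

/-- Parseval on the torus: for real F the squared modulus of the complex coefficient is the sum of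
the squares of the cosine and sine coefficients. -/
lemma summable_coeff_sq (hF : MemLp F 2 (volCube d)) :
    Summable fun k => cosCoeff F k ^ 2 + sinCoeff F k ^ 2 := by
  have h := (UnitAddTorus.hasSum_sq_mFourierCoeff ((memLp_onTorus hF).toLp _)).summable
  refine h.congr fun k => ?_
  have : UnitAddTorus.mFourierCoeff ((memLp_onTorus hF).toLp _) k =
      UnitAddTorus.mFourierCoeff (onTorus F) k :=
    integral_congr_ae (by
      filter_upwards [(memLp_onTorus hF).coeFn_toLp] with t ht
      rw [ht])
  rw [this, mFourierCoeff_onTorus hF, ← Complex.normSq_eq_norm_sq, Complex.normSq_apply]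
  simp
  ring

@[fun_prop] lemma continuous_fourierSum (S : Finset (Fin d → ℤ)) (F : Space d → ℝ) :
    Continuous (fourierSum S F) := by
  unfold fourierSum; fun_prop

/-- The real partial sum is the real part of the complex one, even for a set of frequencies that is
not symmetric. As F is real, passing to real parts does not increase the error, so convergence on
the torus suffices. -/
lemma tendsto_eLpNorm_fourierSum (hF : MemLp F 2 (volCube d)) :
    Filter.Tendsto (fun S => eLpNorm (fourierSum S F - F) 2 (volCube d))
      Filter.atTop (nhds 0) := by
  have h := UnitAddTorus.hasSum_mFourier_series_L2 ((memLp_onTorus hF).toLp _)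
  have h1 := tendsto_iff_edist_tendsto_0.1 h
  refine tendsto_of_tendsto_of_tendsto_of_le_of_le tendsto_const_nhds h1
    (fun _ => zero_le) fun S => ?_
  simp only [Lp.edist_def]
  rw [← eLpNorm_comp_measurePreserving
    ((Lp.aestronglyMeasurable _).sub (Lp.aestronglyMeasurable _)) measurePreserving_toTorus]
  refine eLpNorm_mono_ae ?_
  have e1 : ∀ᵐ t ∂(volume : Measure (UnitAddTorus (Fin d))),
      (∑ k ∈ S, UnitAddTorus.mFourierCoeff ((memLp_onTorus hF).toLp _) k •
        UnitAddTorus.mFourierLp 2 k : Lp ℂ 2 (volume : Measure (UnitAddTorus (Fin d)))) t =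
      ∑ k ∈ S, ((cosCoeff F k : ℂ) - sinCoeff F k * Complex.I) * UnitAddTorus.mFourier k t := by
    have hc : ∀ k, UnitAddTorus.mFourierCoeff ((memLp_onTorus hF).toLp _) k =
        (cosCoeff F k : ℂ) - sinCoeff F k * Complex.I := fun k => by
      rw [← mFourierCoeff_onTorus hF]
      exact integral_congr_ae (by
        filter_upwards [(memLp_onTorus hF).coeFn_toLp] with t ht
        rw [ht])
    simp only [hc]
    refine (Lp.coeFn_finsetSum S _).trans ?_
    have : ∀ᵐ t ∂(volume : Measure (UnitAddTorus (Fin d))), ∀ k ∈ S,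
        (((cosCoeff F k : ℂ) - sinCoeff F k * Complex.I) • UnitAddTorus.mFourierLp 2 k :
          Lp ℂ 2 (volume : Measure (UnitAddTorus (Fin d)))) t =
        ((cosCoeff F k : ℂ) - sinCoeff F k * Complex.I) * UnitAddTorus.mFourier k t := by
      refine (ae_ball_iff S.countable_toSet).2 fun k _ => ?_
      filter_upwards [Lp.coeFn_smul ((cosCoeff F k : ℂ) - sinCoeff F k * Complex.I)
        (UnitAddTorus.mFourierLp 2 k), UnitAddTorus.coeFn_mFourierLp 2 k] with t h1 h2
      rw [h1, Pi.smul_apply, h2, smul_eq_mul]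
    filter_upwards [this] with t ht
    rw [Finset.sum_apply]
    exact Finset.sum_congr rfl ht
  filter_upwards [ae_restrict_mem measurableSet_cube,
    measurePreserving_toTorus.quasiMeasurePreserving.ae e1,
    measurePreserving_toTorus.quasiMeasurePreserving.ae (memLp_onTorus hF).coeFn_toLp]
    with y hy h1 h2
  simp only [Function.comp, Pi.sub_apply]
  rw [h1, h2, onTorus, ofTorus_toTorus hy, Real.norm_eq_abs]
  refine le_trans (le_of_eq ?_) (Complex.abs_re_le_norm _)
  congr 1
  rw [Complex.sub_re, Complex.re_sum, Complex.ofReal_re, fourierSum]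
  congr 1
  refine Finset.sum_congr rfl fun k _ => ?_
  rw [mFourier_toTorus]
  simp only [Complex.mul_re, Complex.sub_re, Complex.sub_im, Complex.add_re, Complex.add_im,
    Complex.mul_im, Complex.ofReal_re, Complex.ofReal_im, Complex.I_re, Complex.I_im]
  ring

/-- A function with absolutely summable Fourier coefficients is bounded. -/
lemma ae_bound_of_summable_coeff (hF : MemLp F 2 (volCube d))
    (h : Summable fun k => √(cosCoeff F k ^ 2 + sinCoeff F k ^ 2)) :
    ∃ M, 0 ≤ M ∧ ∀ᵐ y ∂(volCube d), |F y| ≤ M := by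
  refine ⟨∑' k, √(cosCoeff F k ^ 2 + sinCoeff F k ^ 2), tsum_nonneg fun _ => Real.sqrt_nonneg _, ?_⟩
  -- L² convergence gives convergence in measure, hence a.e. convergence along a sequence of partial
  -- sums. Their uniform bound passes to the limit.
  have hm := tendstoInMeasure_of_tendsto_eLpNorm (p := 2) (by norm_num)
    (fun S => (continuous_fourierSum S F).aestronglyMeasurable) hF.1
    (tendsto_eLpNorm_fourierSum hF)
  obtain ⟨ns, hns⟩ := hm.exists_seq_tendsto_ae'
  filter_upwards [hns.2] with y hy
  refine le_of_tendsto hy.abs (Filter.Eventually.of_forall fun j => ?_)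
  rw [fourierSum]
  refine (Finset.abs_sum_le_sum_abs _ _).trans ?_
  refine le_trans (Finset.sum_le_sum fun k _ => ?_)
    (h.sum_le_tsum _ fun k _ => Real.sqrt_nonneg _)
  refine Real.abs_le_sqrt ?_
  -- Cauchy–Schwarz for the coefficient pair against the unit vector (cos, sin).
  nlinarith [Real.sin_sq_add_cos_sq (phase k y),
    sq_nonneg (cosCoeff F k * Real.sin (phase k y) - sinCoeff F k * Real.cos (phase k y))]

end Fourier


/-! ### Periodic functions -/

section Periodic

variable {d : ℕ}

/-- The integer vector `n` as a point of `ℝᵈ`. -/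
def intVec (n : Fin d → ℤ) : Space d := WithLp.toLp 2 fun i => (n i : ℝ)

@[simp] lemma intVec_apply (n : Fin d → ℤ) (i : Fin d) : intVec n i = n i := rfl

/-- The translate of the half-open unit cell by `n`. -/
def tile (n : Fin d → ℤ) : Set (Space d) := (fun y => y + -intVec n) ⁻¹' cube d

lemma mem_tile {n : Fin d → ℤ} {y : Space d} :
    y ∈ tile n ↔ ∀ i, (n i : ℝ) < y i ∧ y i ≤ n i + 1 := by
  simp [tile, cube, add_comm]

lemma measurableSet_tile (n : Fin d → ℤ) : MeasurableSet (tile n) :=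
  measurableSet_cube.preimage (by fun_prop)

/-- The cells are products of intervals (n, n + 1], closed on the right; hence the ceiling minus one
rather than the floor. -/
lemma mem_tile_iff {n : Fin d → ℤ} {y : Space d} : y ∈ tile n ↔ n = fun i => ⌈y i⌉ - 1 := by
  rw [mem_tile, funext_iff]
  refine forall_congr' fun i => ?_
  rw [eq_sub_iff_add_eq, eq_comm, Int.ceil_eq_iff]
  push_cast
  constructor <;> rintro ⟨h1, h2⟩ <;> constructor <;> linarith

lemma tile_disjoint {n n' : Fin d → ℤ} (h : n ≠ n') : Disjoint (tile n) (tile n') := by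
  rw [Set.disjoint_left]
  intro y h1 h2
  exact h ((mem_tile_iff.1 h1).trans (mem_tile_iff.1 h2).symm)

lemma exists_mem_tile (y : Space d) : ∃ n : Fin d → ℤ, y ∈ tile n := ⟨_, mem_tile_iff.2 rfl⟩

lemma exists_finset_tile {E : Set (Space d)} (hE : Bornology.IsBounded E) :
    ∃ S : Finset (Fin d → ℤ), E ⊆ ⋃ n ∈ S, tile n := by
  obtain ⟨R, hR⟩ := hE.subset_closedBall 0
  refine ⟨Fintype.piFinset fun _ => Finset.Icc (-⌈R⌉ - 1) ⌈R⌉, fun y hy => ?_⟩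
  simp only [mem_iUnion]
  refine ⟨_, ?_, mem_tile_iff.2 rfl⟩
  rw [Fintype.mem_piFinset]
  intro i
  have h1 : |y i| ≤ R := by
    have := hR hy
    rw [mem_closedBall_zero_iff] at this
    exact (PiLp.norm_apply_le y i).trans this
  have h2 := abs_le.1 h1
  rw [Finset.mem_Icc]
  have h3 := Int.le_ceil (y i)
  have h4 := Int.ceil_lt_add_one (y i)
  have h5 := Int.le_ceil R
  constructor
  · have : (-⌈R⌉ : ℝ) ≤ ⌈y i⌉ := by linarith
    have : -⌈R⌉ ≤ ⌈y i⌉ := by exact_mod_cast this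
    linarith
  · have : ⌈y i⌉ ≤ ⌈R⌉ := Int.ceil_le_ceil h2.2
    linarith

/-- Periodicity up to null sets. -/
def AEPeriodic (F : Space d → ℝ) : Prop :=
  ∀ n : Fin d → ℤ, ∀ᵐ y : Space d, F (y + intVec n) = F y

lemma IsPeriodic.add_intVec {f : Space d → ℝ} (hf : IsPeriodic f) (n : Fin d → ℤ) (y : Space d) :
    f (y + intVec n) = f y := by
  -- The periods of a function form a subgroup, so it is enough that the unit vectors belong to it.
  let G : AddSubgroup (Space d) :=
    { carrier := {v | ∀ y, f (y + v) = f y}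
      zero_mem' := by simp
      add_mem' := fun {u v} hu hv y => by rw [← add_assoc, hv, hu]
      neg_mem' := fun {v} hv y => by
        have := hv (y + -v)
        rw [neg_add_cancel_right] at this
        exact this.symm }
  have h : intVec n = ∑ i, n i • stdVec i := by
    ext j
    simp [stdVec, Finset.sum_apply, Pi.single_apply]
  have : intVec n ∈ G := by
    rw [h]
    exact G.sum_mem fun i _ => G.zsmul_mem (fun y => hf i y) _
  exact this y

lemma IsPeriodic.aePeriodic {f : Space d → ℝ} (hf : IsPeriodic f) : AEPeriodic f :=
  fun n => ae_of_all _ fun y => hf.add_intVec n y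

lemma AEPeriodic.mul {F G : Space d → ℝ} (hF : AEPeriodic F) (hG : AEPeriodic G) :
    AEPeriodic fun y => F y * G y := fun n => by
  filter_upwards [hF n, hG n] with y h1 h2
  rw [h1, h2]

lemma AEPeriodic.sub {F G : Space d → ℝ} (hF : AEPeriodic F) (hG : AEPeriodic G) :
    AEPeriodic (F - G) := fun n => by
  filter_upwards [hF n, hG n] with y h1 h2
  simp [h1, h2]

lemma AEPeriodic.sum {ι : Type*} (s : Finset ι) {F : ι → Space d → ℝ}
    (hF : ∀ i ∈ s, AEPeriodic (F i)) : AEPeriodic fun y => ∑ i ∈ s, F i y := fun n => by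
  have : ∀ᵐ y : Space d, ∀ i ∈ s, F i (y + intVec n) = F i y :=
    (ae_ball_iff s.countable_toSet).2 fun i hi => hF i hi n
  filter_upwards [this] with y hy
  exact Finset.sum_congr rfl hy

lemma lintegral_tile (F : Space d → ENNReal) (n : Fin d → ℤ) :
    ∫⁻ y in tile n, F y = ∫⁻ y in cube d, F (y + intVec n) := by
  have h := (measurePreserving_add_right (volume : Measure (Space d))
    (-intVec n)).setLIntegral_comp_preimage_emb
    (MeasurableEquiv.addRight (-intVec n)).measurableEmbedding (fun y => F (y + intVec n)) (cube d)
  rw [← h, tile]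
  simp

lemma integral_tile (F : Space d → ℝ) (n : Fin d → ℤ) :
    ∫ y in tile n, F y = ∫ y in cube d, F (y + intVec n) := by
  have h := (measurePreserving_add_right (volume : Measure (Space d))
    (-intVec n)).setIntegral_preimage_emb
    (MeasurableEquiv.addRight (-intVec n)).measurableEmbedding (fun y => F (y + intVec n)) (cube d)
  rw [← h, tile]
  simp

lemma quasiMeasurePreserving_smul {c : ℝ} (hc : c ≠ 0) :
    Measure.QuasiMeasurePreserving (fun x : Space d => c • x) volume volume := by
  refine ⟨by fun_prop, ?_⟩
  rw [Measure.map_addHaar_smul volume hc]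
  exact Measure.smul_absolutelyContinuous

/-- The `L²` norm of an oscillating function on a bounded set is controlled by the `L²` norm over
the cell. -/
lemma exists_eLpNorm_osc_le {E : Set (Space d)} (hE : Bornology.IsBounded E) {ε : ℝ}
    (hε : 0 < ε) : ∃ K : ENNReal, K ≠ ⊤ ∧ ∀ F : Space d → ℝ, AEPeriodic F →
      eLpNorm (osc ε F) 2 (volume.restrict E) ≤ K * eLpNorm F 2 (volCube d) := by
  obtain ⟨S, hS⟩ := exists_finset_tile (hE.smul₀ ε⁻¹)
  set c : ENNReal := ENNReal.ofReal |((ε⁻¹) ^ Module.finrank ℝ (Space d))⁻¹| with hc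
  have hε' : ε⁻¹ ≠ 0 := by positivity
  -- The factor is the Jacobian of the scaling times the number of cells meeting the rescaled set.
  -- It may depend on ε: it serves only for integrability and for limits at fixed ε, never in the
  -- final constant.
  refine ⟨(c * S.card) ^ (1 / 2 : ℝ), ?_, fun F hF => ?_⟩
  · exact ENNReal.rpow_ne_top_of_nonneg (by norm_num) (ENNReal.mul_ne_top (by simp [hc]) (by simp))
  have key : ∫⁻ x in E, ‖osc ε F x‖ₑ ^ (2 : ℝ) ≤
      c * S.card * ∫⁻ y in cube d, ‖F y‖ₑ ^ (2 : ℝ) := by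
    have hemb : MeasurableEmbedding (fun x : Space d => ε⁻¹ • x) :=
      (Homeomorph.smulOfNeZero ε⁻¹ hε').measurableEmbedding
    have hsub : E ⊆ (fun x : Space d => ε⁻¹ • x) ⁻¹' (⋃ n ∈ S, tile n) := fun x hx =>
      hS (Set.smul_mem_smul_set hx)
    have hmeas : MeasurableSet (⋃ n ∈ S, tile n) :=
      Finset.measurableSet_biUnion S fun n _ => measurableSet_tile n
    calc ∫⁻ x in E, ‖osc ε F x‖ₑ ^ (2 : ℝ)
        ≤ ∫⁻ x in (fun x : Space d => ε⁻¹ • x) ⁻¹' (⋃ n ∈ S, tile n), ‖F (ε⁻¹ • x)‖ₑ ^ (2 : ℝ) :=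
          lintegral_mono_set hsub
      _ = ∫⁻ y in ⋃ n ∈ S, tile n, ‖F y‖ₑ ^ (2 : ℝ) ∂(Measure.map (fun x => ε⁻¹ • x) volume) := by
          rw [hemb.restrict_map, hemb.lintegral_map]
      _ = c * ∑ n ∈ S, ∫⁻ y in tile n, ‖F y‖ₑ ^ (2 : ℝ) := by
          rw [Measure.map_addHaar_smul volume hε', Measure.restrict_smul, lintegral_smul_measure,
            lintegral_biUnion_finset (fun n _ n' _ h => tile_disjoint h)
              (fun n _ => measurableSet_tile n)]
          rfl
      _ = c * ∑ n ∈ S, ∫⁻ y in cube d, ‖F y‖ₑ ^ (2 : ℝ) := by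
          congr 1
          refine Finset.sum_congr rfl fun n _ => ?_
          rw [lintegral_tile]
          refine lintegral_congr_ae (ae_restrict_of_ae ?_)
          filter_upwards [hF n] with y hy
          rw [hy]
      _ = c * S.card * ∫⁻ y in cube d, ‖F y‖ₑ ^ (2 : ℝ) := by
          rw [Finset.sum_const, nsmul_eq_mul, mul_assoc]
  rw [eLpNorm_eq_lintegral_rpow_enorm_toReal (by norm_num) (by norm_num),
    eLpNorm_eq_lintegral_rpow_enorm_toReal (by norm_num) (by norm_num)]
  simp only [ENNReal.toReal_ofNat]
  rw [← ENNReal.mul_rpow_of_nonneg _ _ (by norm_num)]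
  exact ENNReal.rpow_le_rpow key (by norm_num)

lemma AEPeriodic.ae_bound {F : Space d → ℝ} (hF : AEPeriodic F) {M : ℝ}
    (h : ∀ᵐ y ∂(volCube d), |F y| ≤ M) : ∀ᵐ y : Space d, |F y| ≤ M := by
  have h1 : ∀ n : Fin d → ℤ, ∀ᵐ y : Space d, y ∈ tile n → |F y| ≤ M := fun n => by
    have h2 := (ae_restrict_iff' measurableSet_cube).1 h
    have h3 := (measurePreserving_add_right (volume : Measure (Space d))
      (-intVec n)).quasiMeasurePreserving.ae h2
    have h4 := (measurePreserving_add_right (volume : Measure (Space d))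
      (-intVec n)).quasiMeasurePreserving.ae (hF n)
    filter_upwards [h3, h4] with y h5 h6 hy
    rw [neg_add_cancel_right] at h6
    rw [h6]
    exact h5 hy
  filter_upwards [ae_all_iff.2 h1] with y hy
  obtain ⟨n, hn⟩ := exists_mem_tile y
  exact hy n hn

lemma ae_osc {p : ℝ → Prop} {F : Space d → ℝ} {ε : ℝ} (hε : 0 < ε) (h : ∀ᵐ y, p (F y)) :
    ∀ᵐ x, p (osc ε F x) :=
  (quasiMeasurePreserving_smul (inv_ne_zero hε.ne')).ae h

lemma aestronglyMeasurable_osc {F : Space d → ℝ} {ε : ℝ} (hε : 0 < ε)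
    (h : AEStronglyMeasurable F volume) : AEStronglyMeasurable (osc ε F) volume :=
  h.comp_quasiMeasurePreserving (quasiMeasurePreserving_smul (inv_ne_zero hε.ne'))

/-! ### Weak derivatives of periodic functions -/

lemma restrict_top : (volume.restrict ((⊤ : Opens (Space d)) : Set (Space d))) = volume := by
  simp

lemma locallyIntegrable_of_top {f : Space d → ℝ}
    (h : LocallyIntegrableOn f (⊤ : Opens (Space d)) volume) : LocallyIntegrable f volume := by
  rwa [Opens.coe_top, locallyIntegrableOn_univ] at h

/-- The translate of a test function on the whole space. -/
def testTranslate (v : Space d) (φ : 𝓓((⊤ : Opens (Space d)), ℝ)) :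
    𝓓((⊤ : Opens (Space d)), ℝ) where
  toFun x := φ (x - v)
  contDiff' := φ.contDiff.comp (contDiff_id.sub contDiff_const)
  hasCompactSupport' := φ.hasCompactSupport.comp_homeomorph (Homeomorph.subRight v)
  tsupport_subset' := by simp

lemma testDeriv_testTranslate {m : ℕ} (w : Fin m → Fin d) (v : Space d)
    (φ : 𝓓((⊤ : Opens (Space d)), ℝ)) (x : Space d) :
    testDeriv w (testTranslate v φ) x = testDeriv w φ (x - v) := by
  rw [testDeriv, testDeriv, ← iteratedFDeriv_apply, ← iteratedFDeriv_apply]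
  have := iteratedFDeriv_comp_sub (𝕜 := ℝ) (f := fun y => φ y) m v x
  exact DFunLike.congr_fun this fun j => stdVec (w j)

@[simp] lemma testTranslate_apply (v : Space d) (φ : 𝓓((⊤ : Opens (Space d)), ℝ)) (x : Space d) :
    testTranslate v φ x = φ (x - v) := rfl

/-- A translate of g by an integer vector is again a weak derivative of f, because f is periodic;
uniqueness of weak derivatives then gives equality almost everywhere. -/
lemma HasWeakDeriv.aePeriodic {f g : Space d → ℝ} {m : ℕ} {w : Fin m → Fin d}
    (hf : IsPeriodic f) (h : HasWeakDeriv ⊤ w f g) : AEPeriodic g := fun n => by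
  have hmp := measurePreserving_add_right (volume : Measure (Space d)) (intVec n)
  have hemb := (MeasurableEquiv.addRight (intVec n)).measurableEmbedding
  have h' : HasWeakDeriv ⊤ w f (fun y => g (y + intVec n)) := by
    refine hasWeakDeriv_iff.2 ⟨h.1, ?_, fun φ => ?_⟩
    · rw [Opens.coe_top, locallyIntegrableOn_univ, locallyIntegrable_iff]
      intro K hK
      have := (locallyIntegrable_of_top h.2.1).integrableOn_isCompact
        (hK.image (f := fun y => y + intVec n) (by fun_prop))
      rw [← hmp.integrableOn_comp_preimage hemb] at this
      exact this.mono_set (subset_preimage_image _ _)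
    · have e := h.integral_eq (testTranslate (intVec n) φ)
      simp only [testDeriv_testTranslate, restrict_top, testTranslate_apply] at e ⊢
      rw [← hmp.integral_comp hemb (fun y => f y * testDeriv w φ (y - intVec n)),
        ← hmp.integral_comp hemb (fun y => g y * φ (y - intVec n))] at e
      simp only [add_sub_cancel_right, hf.add_intVec n] at e
      exact e
  have := h'.ae_eq h
  rwa [restrict_top] at this

/-! ### A periodic partition of unity -/

/-- A one-dimensional bump function whose integer translates sum up to one. -/
def bump1 (t : ℝ) : ℝ := Real.smoothTransition (1 + t) * Real.smoothTransition (1 - t)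

lemma smoothTransition_add (t : ℝ) :
    Real.smoothTransition t + Real.smoothTransition (1 - t) = 1 := by
  have h := Real.smoothTransition.pos_denom t
  rw [Real.smoothTransition, Real.smoothTransition, sub_sub_cancel,
    add_comm (expNegInvGlue (1 - t)), ← add_div, div_self h.ne']

lemma bump1_add {t : ℝ} (h0 : 0 ≤ t) (h1 : t ≤ 1) : bump1 t + bump1 (t + (-1 : ℤ)) = 1 := by
  rw [bump1, bump1, Real.smoothTransition.one_of_one_le (by linarith : 1 ≤ 1 + t)]
  push_cast
  rw [Real.smoothTransition.one_of_one_le (by linarith : 1 ≤ 1 - (t + -1)), one_mul, mul_one,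
    add_comm, show 1 + (t + -1) = t by ring]
  exact smoothTransition_add t

lemma bump1_eq_zero {t : ℝ} (h : 1 ≤ |t|) : bump1 t = 0 := by
  rw [bump1]
  rcases le_abs'.1 h with h | h
  · rw [Real.smoothTransition.zero_of_nonpos (by linarith), zero_mul]
  · rw [Real.smoothTransition.zero_of_nonpos (by linarith : 1 - t ≤ 0), mul_zero]

/-- A bump function whose integer translates sum up to one. -/
def bump (d : ℕ) : 𝓓((⊤ : Opens (Space d)), ℝ) where
  toFun x := ∏ i, bump1 (x i)
  contDiff' := by
    refine contDiff_prod fun i _ => ?_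
    unfold bump1
    have h1 : ContDiff ℝ (⊤ : ℕ∞) fun x : Space d => x i := by fun_prop
    exact (Real.smoothTransition.contDiff.comp (contDiff_const.add h1)).mul
      (Real.smoothTransition.contDiff.comp (contDiff_const.sub h1))
  hasCompactSupport' := by
    refine HasCompactSupport.of_support_subset_isCompact
      (isCompact_closedBall (0 : Space d) (Real.sqrt d)) fun x hx => ?_
    rw [mem_closedBall_zero_iff, EuclideanSpace.norm_eq]
    refine Real.sqrt_le_sqrt ?_
    have : ∀ i ∈ Finset.univ, ‖x i‖ ^ 2 ≤ 1 := fun i _ => by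
      have h : |x i| < 1 := by
        by_contra hc
        exact hx (Finset.prod_eq_zero (Finset.mem_univ i) (bump1_eq_zero (not_lt.1 hc)))
      rw [Real.norm_eq_abs]
      nlinarith [abs_nonneg (x i)]
    simpa using Finset.sum_le_sum this
  tsupport_subset' := by simp

lemma bump_apply (x : Space d) : bump d x = ∏ i, bump1 (x i) := rfl

/-- The lattice points needed to cover the support of the bump function. -/
def bumpSet (d : ℕ) : Finset (Fin d → ℤ) := Fintype.piFinset fun _ => {0, -1}

/-- The sum over the product set {0, -1}ᵈ factorises into one-dimensional sums, each equal to one.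
-/
lemma sum_bump {y : Space d} (hy : ∀ i, y i ∈ Ioo (0 : ℝ) 1) :
    ∑ n ∈ bumpSet d, bump d (y + intVec n) = 1 := by
  simp only [bump_apply, bumpSet, PiLp.add_apply, intVec_apply]
  rw [← Finset.prod_univ_sum (fun _ => ({0, -1} : Finset ℤ)) fun i n => bump1 (y i + (n : ℝ))]
  refine Finset.prod_eq_one fun i _ => ?_
  rw [Finset.sum_pair (by norm_num)]
  simpa using bump1_add (hy i).1.le (hy i).2.le

lemma bump_support {y : Space d} (hy : y ∉ ⋃ n ∈ bumpSet d, tile n) : bump d y = 0 := by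
  by_contra hne
  refine hy ?_
  have h : ∀ i, |y i| < 1 := fun i => by
    by_contra hc
    exact hne (Finset.prod_eq_zero (Finset.mem_univ i) (bump1_eq_zero (not_lt.1 hc)))
  simp only [mem_iUnion]
  refine ⟨fun i => ⌈y i⌉ - 1, ?_, mem_tile_iff.2 rfl⟩
  rw [bumpSet, Fintype.mem_piFinset]
  intro i
  have h2 := abs_lt.1 (h i)
  have h3 : ⌈y i⌉ ≤ 1 := Int.ceil_le.2 (by simpa using h2.2.le)
  have h4 : -1 < ⌈y i⌉ := Int.lt_ceil.2 (by simpa using h2.1)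
  have : ⌈y i⌉ = 0 ∨ ⌈y i⌉ = 1 := by omega
  rcases this with h | h <;> simp [h]

lemma ae_mem_interior_cube : ∀ᵐ y ∂(volCube d), ∀ i, y i ∈ Ioo (0 : ℝ) 1 := by
  have h : (WithLp.ofLp : Space d → Fin d → ℝ) ⁻¹' (Set.univ.pi fun _ => Ioo (0 : ℝ) 1)
      =ᵐ[volume] cube d := by
    rw [cube_eq_preimage]
    refine (PiLp.volume_preserving_ofLp (Fin d)).quasiMeasurePreserving.preimage_ae_eq ?_
    exact (Measure.univ_pi_Ioo_ae_eq_Icc (ι := Fin d) (μ := fun _ => (volume : Measure ℝ))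
      (f := fun _ => 0) (g := fun _ => 1)).trans
      (Measure.univ_pi_Ioc_ae_eq_Icc (ι := Fin d) (μ := fun _ => (volume : Measure ℝ))
      (f := fun _ => 0) (g := fun _ => 1)).symm
  rw [volCube, ae_restrict_iff' measurableSet_cube]
  filter_upwards [h] with y hy hc
  have : y ∈ (WithLp.ofLp : Space d → Fin d → ℝ) ⁻¹' (Set.univ.pi fun _ => Ioo (0 : ℝ) 1) := by
    rw [eq_iff_iff] at hy
    exact hy.2 hc
  simpa using this

/-- Unfolding: the integral of a periodic function against a function supported near the cell. -/
lemma integral_mul_eq_cube {F Φ : Space d → ℝ} (hF : AEPeriodic F)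
    (hi : Integrable (fun y => F y * Φ y)) (hΦ : ∀ y, y ∉ ⋃ n ∈ bumpSet d, tile n → Φ y = 0) :
    ∫ y, F y * Φ y = ∫ y in cube d, F y * ∑ n ∈ bumpSet d, Φ (y + intVec n) := by
  have h1 : ∫ y, F y * Φ y = ∫ y in ⋃ n ∈ bumpSet d, tile n, F y * Φ y :=
    (setIntegral_eq_integral_of_forall_compl_eq_zero fun y hy => by simp [hΦ y hy]).symm
  have e : ∀ n, ∀ᵐ y ∂(volCube d), F (y + intVec n) * Φ (y + intVec n) =
      F y * Φ (y + intVec n) := fun n => by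
    refine ae_restrict_of_ae ?_
    filter_upwards [hF n] with y hy
    rw [hy]
  have hint : ∀ n ∈ bumpSet d, Integrable (fun y => F y * Φ (y + intVec n)) (volCube d) := by
    intro n _
    refine Integrable.congr ?_ (e n)
    exact (((measurePreserving_add_right (volume : Measure (Space d)) (intVec n)).integrable_comp_emb
      (MeasurableEquiv.addRight (intVec n)).measurableEmbedding).2 hi).restrict
  rw [h1, integral_biUnion_finset _ (fun n _ => measurableSet_tile n)
    (fun n _ n' _ h => tile_disjoint h) (fun n _ => hi.integrableOn)]
  simp only [Finset.mul_sum]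
  rw [integral_finsetSum _ hint]
  refine Finset.sum_congr rfl fun n _ => ?_
  rw [integral_tile]
  exact integral_congr_ae (e n)

/-- The bump is nonnegative and vanishes at y, so y is a minimum. This also covers points on the
boundary of the half-open cells, where the bump need not vanish in a neighbourhood for an obvious
reason. -/
lemma bump_deriv_support (j : Fin d) {y : Space d} (hy : y ∉ ⋃ n ∈ bumpSet d, tile n) :
    testDeriv ![j] (bump d) y = 0 := by
  rw [testDeriv_one, lineDeriv_apply]
  have hmin : IsLocalMin (bump d) y := by
    refine Filter.Eventually.of_forall fun z => ?_
    rw [bump_support hy, bump_apply]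
    refine Finset.prod_nonneg fun i _ => ?_
    exact mul_nonneg (Real.smoothTransition.nonneg _) (Real.smoothTransition.nonneg _)
  rw [hmin.fderiv_eq_zero]
  rfl

lemma sum_bump_deriv (j : Fin d) {y : Space d} (hy : ∀ i, y i ∈ Ioo (0 : ℝ) 1) :
    ∑ n ∈ bumpSet d, testDeriv ![j] (bump d) (y + intVec n) = 0 := by
  have hopen : IsOpen {y : Space d | ∀ i, y i ∈ Ioo (0 : ℝ) 1} := by
    simp only [ofPred_forall]
    refine isOpen_iInter_of_finite fun i => ?_
    exact isOpen_Ioo.preimage (f := fun y : Space d => y i) (by fun_prop)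
  have h1 : (fun y => ∑ n ∈ bumpSet d, bump d (y + intVec n)) =ᶠ[nhds y] fun _ => 1 := by
    filter_upwards [hopen.mem_nhds hy] with z hz
    exact sum_bump hz
  have h2 := h1.fderiv_eq (𝕜 := ℝ)
  rw [fderiv_fun_sum (A := fun n y => bump d (y + intVec n))
    (fun n _ => ((test_differentiable (bump d)).comp (differentiable_id.add_const _)) y)] at h2
  have h3 := congrArg (fun L => L (stdVec j)) h2
  simp only [fderiv_comp_add_right, sum_apply] at h3
  simp only [testDeriv_one, lineDeriv_apply]
  rw [h3]
  simp

/-- Integration by parts over the cell for periodic functions. -/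
lemma integral_cube_by_parts {f g q : Space d → ℝ} {j : Fin d} (hf : AEPeriodic f)
    (hg : AEPeriodic g) (h : HasWeakDeriv ⊤ ![j] f g) (hq : ContDiff ℝ (⊤ : ℕ∞) q)
    (hqp : AEPeriodic q) (hqp' : AEPeriodic fun y => fderiv ℝ q y (stdVec j)) :
    ∫ y in cube d, f y * fderiv ℝ q y (stdVec j) = - ∫ y in cube d, g y * q y := by
  -- The weak derivative is tested with q times the bump. Folding the integrals back onto the cell,
  -- the translates of the bump sum to one and those of its derivative sum to zero, so only the
  -- periodic integrands remain.
  have e := h.integral_eq (smoothMul q hq (bump d))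
  simp only [testDeriv_smoothMul, restrict_top, smoothMul_apply, pow_one] at e
  have hcont : Continuous fun y => fderiv ℝ q y (stdVec j) :=
    (hq.continuous_fderiv (by simp)).clm_apply continuous_const
  have integ : ∀ (F Q : Space d → ℝ) (ψ : 𝓓((⊤ : Opens (Space d)), ℝ)),
      LocallyIntegrable F → Continuous Q → Integrable fun y => (F y * Q y) * ψ y := by
    intro F Q ψ hF hQ
    have := integrable_mul_test (D := ⊤) (f := fun y => F y * Q y) ?_ ψ
    · rwa [restrict_top] at this
    · rw [Opens.coe_top, locallyIntegrableOn_univ]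
      exact hF.mul_continuous hQ
  have hfl := locallyIntegrable_of_top h.1
  have hgl := locallyIntegrable_of_top h.2.1
  have i1 := integ f q (testDeriv ![j] (bump d)) hfl hq.continuous
  have i2 := integ f _ (bump d) hfl hcont
  have i3 := integ g q (bump d) hgl hq.continuous
  have e1 := integral_mul_eq_cube (hf.mul hqp) i1 fun y hy => bump_deriv_support j hy
  have e2 := integral_mul_eq_cube (hf.mul hqp') i2 fun y hy => bump_support hy
  have e3 := integral_mul_eq_cube (hg.mul hqp) i3 fun y hy => bump_support hy
  have e1' : ∫ y in cube d, (f y * q y) * ∑ n ∈ bumpSet d,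
      testDeriv ![j] (bump d) (y + intVec n) = 0 := by
    rw [← integral_zero (Space d) ℝ (μ := volCube d)]
    refine integral_congr_ae ?_
    filter_upwards [ae_mem_interior_cube] with y hy
    rw [sum_bump_deriv j hy, mul_zero]
  have one : ∀ F : Space d → ℝ, ∫ y in cube d, F y * ∑ n ∈ bumpSet d,
      bump d (y + intVec n) = ∫ y in cube d, F y := by
    intro F
    refine integral_congr_ae ?_
    filter_upwards [ae_mem_interior_cube] with y hy
    rw [sum_bump hy, mul_one]
  rw [one] at e2 e3
  rw [e1'] at e1
  have e4 : ∫ y, f y * (q y * testDeriv ![j] (bump d) y + fderiv ℝ q y (stdVec j) * bump d y) =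
      (∫ y, f y * q y * testDeriv ![j] (bump d) y) +
        ∫ y, f y * fderiv ℝ q y (stdVec j) * bump d y := by
    rw [← integral_add i1 i2]
    refine integral_congr_ae (ae_of_all _ fun y => ?_)
    ring
  rw [e4, e1, e2, zero_add] at e
  rw [e, ← e3]
  simp only [mul_assoc]
  ring

end Periodic


/-! ### Fourier coefficients of weak derivatives -/

section Coeff

variable {d : ℕ}

/-- The phase as a linear form. -/
def phaseCLM (k : Fin d → ℤ) : Space d →L[ℝ] ℝ :=
  (2 * Real.pi) • ∑ i, (k i : ℝ) • (EuclideanSpace.proj i : Space d →L[ℝ] ℝ)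

lemma phase_eq_clm (k : Fin d → ℤ) : phase k = phaseCLM k := by
  ext y
  simp [phase, phaseCLM]

lemma contDiff_phase (k : Fin d → ℤ) {n : WithTop ℕ∞} : ContDiff ℝ n (phase k) := by
  rw [phase_eq_clm]
  exact (phaseCLM k).contDiff

lemma fderiv_phase (k : Fin d → ℤ) (y : Space d) (j : Fin d) :
    fderiv ℝ (phase k) y (stdVec j) = 2 * Real.pi * k j := by
  rw [phase_eq_clm, ContinuousLinearMap.fderiv]
  simp [phaseCLM, stdVec]

lemma differentiable_phase (k : Fin d → ℤ) : Differentiable ℝ (phase k) :=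
  (contDiff_phase k (n := 1)).differentiable (by simp)

lemma fderiv_cos_phase (k : Fin d → ℤ) (y : Space d) (j : Fin d) :
    fderiv ℝ (fun y => Real.cos (phase k y)) y (stdVec j) =
      -(2 * Real.pi * k j) * Real.sin (phase k y) := by
  rw [fderiv_cos (differentiable_phase k y), smul_apply, fderiv_phase,
    smul_eq_mul]
  ring

lemma fderiv_sin_phase (k : Fin d → ℤ) (y : Space d) (j : Fin d) :
    fderiv ℝ (fun y => Real.sin (phase k y)) y (stdVec j) =
      (2 * Real.pi * k j) * Real.cos (phase k y) := by
  rw [fderiv_sin (differentiable_phase k y), smul_apply, fderiv_phase,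
    smul_eq_mul]
  ring

lemma phase_add_intVec (k n : Fin d → ℤ) (y : Space d) :
    phase k (y + intVec n) = phase k y + (∑ i, k i * n i : ℤ) * (2 * Real.pi) := by
  simp only [phase, PiLp.add_apply, intVec_apply, mul_add, Finset.sum_add_distrib]
  push_cast
  ring

lemma aePeriodic_cos (k : Fin d → ℤ) (c : ℝ) : AEPeriodic fun y => c * Real.cos (phase k y) :=
  fun n => ae_of_all _ fun y => by
    simp only [phase_add_intVec, Real.cos_add_int_mul_two_pi]

lemma aePeriodic_sin (k : Fin d → ℤ) (c : ℝ) : AEPeriodic fun y => c * Real.sin (phase k y) :=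
  fun n => ae_of_all _ fun y => by
    simp only [phase_add_intVec, Real.sin_add_int_mul_two_pi]

/-- `g` is the `j`-th weak derivative of the periodic function `f`, and both are square integrable
over the cell. -/
structure IsPeriodicDeriv (j : Fin d) (f g : Space d → ℝ) : Prop where
  deriv : HasWeakDeriv ⊤ ![j] f g
  per : AEPeriodic f
  per' : AEPeriodic g
  memLp : MemLp f 2 (volCube d)
  memLp' : MemLp g 2 (volCube d)

variable {f g F G : Space d → ℝ} {i j : Fin d}

lemma IsPeriodicDeriv.cosCoeff (h : IsPeriodicDeriv j f g) (k : Fin d → ℤ) :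
    cosCoeff g k = 2 * Real.pi * k j * sinCoeff f k := by
  have e := integral_cube_by_parts h.per h.per' h.deriv
    (q := fun y => Real.cos (phase k y)) (Real.contDiff_cos.comp (contDiff_phase k))
    (by simpa using aePeriodic_cos k 1)
    (by simp only [fderiv_cos_phase]; exact aePeriodic_sin k _)
  simp only [fderiv_cos_phase] at e
  rw [Homog.cosCoeff, ← neg_eq_iff_eq_neg.2 e, Homog.sinCoeff, ← integral_neg,
    ← integral_const_mul]
  refine integral_congr_ae (ae_of_all _ fun y => ?_)
  ring

lemma IsPeriodicDeriv.sinCoeff (h : IsPeriodicDeriv j f g) (k : Fin d → ℤ) :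
    sinCoeff g k = -(2 * Real.pi * k j) * Homog.cosCoeff f k := by
  have e := integral_cube_by_parts h.per h.per' h.deriv
    (q := fun y => Real.sin (phase k y)) (Real.contDiff_sin.comp (contDiff_phase k))
    (by simpa using aePeriodic_sin k 1)
    (by simp only [fderiv_sin_phase]; exact aePeriodic_cos k _)
  simp only [fderiv_sin_phase] at e
  rw [Homog.sinCoeff, ← neg_eq_iff_eq_neg.2 e, Homog.cosCoeff, ← integral_neg,
    ← integral_const_mul]
  refine integral_congr_ae (ae_of_all _ fun y => ?_)
  ring

lemma contDiff_fourierSum (S : Finset (Fin d → ℤ)) (F : Space d → ℝ) :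
    ContDiff ℝ (⊤ : ℕ∞) (fourierSum S F) := by
  unfold fourierSum
  refine ContDiff.sum fun k _ => ?_
  exact (contDiff_const.mul (Real.contDiff_cos.comp (contDiff_phase k))).add
    (contDiff_const.mul (Real.contDiff_sin.comp (contDiff_phase k)))

/-- Truncation commutes with differentiation. One family of trigonometric polynomials thus
approximates f and its weak derivatives simultaneously. -/
lemma IsPeriodicDeriv.fderiv_fourierSum (h : IsPeriodicDeriv j f g) (S : Finset (Fin d → ℤ))
    (y : Space d) : fderiv ℝ (fourierSum S f) y (stdVec j) = fourierSum S g y := by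
  have hc : ∀ k : Fin d → ℤ, DifferentiableAt ℝ (fun y => Real.cos (phase k y)) y := fun k =>
    (differentiable_phase k y).cos
  have hs : ∀ k : Fin d → ℤ, DifferentiableAt ℝ (fun y => Real.sin (phase k y)) y := fun k =>
    (differentiable_phase k y).sin
  have e : fourierSum S f = fun y => ∑ k ∈ S, (Homog.cosCoeff f k * Real.cos (phase k y) +
      Homog.sinCoeff f k * Real.sin (phase k y)) := rfl
  rw [e, fderiv_fun_sum (A := fun k y => Homog.cosCoeff f k * Real.cos (phase k y) +
      Homog.sinCoeff f k * Real.sin (phase k y))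
      (fun k _ => ((hc k).const_mul _).add ((hs k).const_mul _)),
    sum_apply, fourierSum]
  refine Finset.sum_congr rfl fun k _ => ?_
  rw [fderiv_fun_add ((hc k).const_mul _) ((hs k).const_mul _), fderiv_const_mul (hc k),
    fderiv_const_mul (hs k), add_apply, smul_apply,
    smul_apply, fderiv_cos_phase, fderiv_sin_phase, h.cosCoeff, h.sinCoeff]
  simp only [smul_eq_mul]
  ring

lemma aePeriodic_fourierSum (S : Finset (Fin d → ℤ)) (F : Space d → ℝ) :
    AEPeriodic (fourierSum S F) := by
  refine AEPeriodic.sum S fun k _ n => ?_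
  filter_upwards [aePeriodic_cos k (cosCoeff F k) n, aePeriodic_sin k (sinCoeff F k) n]
    with y h1 h2
  rw [h1, h2]

/-- The modulus of the `k`-th Fourier coefficient. -/
def coeffNorm (F : Space d → ℝ) (k : Fin d → ℤ) : ℝ := √(cosCoeff F k ^ 2 + sinCoeff F k ^ 2)

lemma coeffNorm_nonneg (F : Space d → ℝ) (k : Fin d → ℤ) : 0 ≤ coeffNorm F k := Real.sqrt_nonneg _

lemma coeffNorm_congr (h : F =ᵐ[volume] G) (k : Fin d → ℤ) : coeffNorm F k = coeffNorm G k := by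
  have h' : F =ᵐ[volCube d] G := ae_restrict_of_ae h
  rw [coeffNorm, coeffNorm, cosCoeff, cosCoeff, sinCoeff, sinCoeff]
  congr 3
  · exact integral_congr_ae (by filter_upwards [h'] with y hy; rw [hy])
  · exact integral_congr_ae (by filter_upwards [h'] with y hy; rw [hy])

lemma coeffNorm_const_mul (c : ℝ) (F : Space d → ℝ) (k : Fin d → ℤ) :
    coeffNorm (fun y => c * F y) k = |c| * coeffNorm F k := by
  have h1 : cosCoeff (fun y => c * F y) k = c * cosCoeff F k := by
    simp only [cosCoeff, mul_assoc, integral_const_mul]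
  have h2 : sinCoeff (fun y => c * F y) k = c * sinCoeff F k := by
    simp only [sinCoeff, mul_assoc, integral_const_mul]
  rw [coeffNorm, h1, h2, coeffNorm, ← Real.sqrt_sq_eq_abs, ← Real.sqrt_mul (sq_nonneg c)]
  congr 1
  ring

lemma IsPeriodicDeriv.coeffNorm (h : IsPeriodicDeriv j f g) (k : Fin d → ℤ) :
    coeffNorm g k = 2 * Real.pi * |(k j : ℝ)| * Homog.coeffNorm f k := by
  have hp : 2 * Real.pi * |(k j : ℝ)| = √((2 * Real.pi * k j) ^ 2) := by
    rw [Real.sqrt_sq_eq_abs, abs_mul, abs_of_pos (by positivity : 0 < 2 * Real.pi)]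
  rw [hp, Homog.coeffNorm, Homog.coeffNorm, h.cosCoeff, h.sinCoeff,
    ← Real.sqrt_mul (sq_nonneg _)]
  congr 1
  ring

/-! ### Fourier coefficients of functions in H²_♯(Y). -/

section Hper

lemma MemHper2.weakDeriv (h : MemHper2 f) {m : ℕ} (hm : m ≤ 2) (w : Fin m → Fin d) :
    HasWeakDeriv ⊤ w f (weakDeriv ⊤ w f) ∧ AEPeriodic (Homog.weakDeriv ⊤ w f) ∧
      MemLp (Homog.weakDeriv ⊤ w f) 2 (volCube d) := by
  obtain ⟨g, h1, h2⟩ := h.2 m hm w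
  have h3 := h1.hasWeakDeriv_weakDeriv
  refine ⟨h3, h3.aePeriodic h.1, ?_⟩
  have e := h1.weakDeriv_ae_eq
  rw [restrict_top] at e
  rw [restrict_unitCell] at h2
  exact (memLp_congr_ae (ae_restrict_of_ae e)).2 h2

lemma MemHper2.memLp (h : MemHper2 f) : MemLp f 2 (volCube d) := by
  obtain ⟨g, h1, h2⟩ := h.2 0 (by norm_num) ![]
  have e := h1.ae_eq (hasWeakDeriv_zero _ h1.1)
  rw [restrict_top] at e
  rw [restrict_unitCell] at h2
  exact (memLp_congr_ae (ae_restrict_of_ae e)).1 h2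

lemma MemHper2.isPeriodicDeriv (h : MemHper2 f) (i : Fin d) :
    IsPeriodicDeriv i f (Homog.weakDeriv ⊤ ![i] f) :=
  let ⟨h1, h2, h3⟩ := h.weakDeriv (by norm_num) ![i]
  ⟨h1, h.1.aePeriodic, h2, h.memLp, h3⟩

lemma MemHper2.isPeriodicDeriv₂ (h : MemHper2 f) (i j : Fin d) :
    IsPeriodicDeriv j (Homog.weakDeriv ⊤ ![i] f) (Homog.weakDeriv ⊤ ![i, j] f) :=
  let ⟨h1, h2, h3⟩ := h.weakDeriv (by norm_num) ![i]
  let ⟨h4, h5, h6⟩ := h.weakDeriv le_rfl ![i, j]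
  ⟨h1.of_cons h4, h2, h5, h3, h6⟩

/-- The square of the length of a frequency. -/
def freqSq (k : Fin d → ℤ) : ℝ := ∑ i, (k i : ℝ) ^ 2

lemma sq_le_freqSq (k : Fin d → ℤ) (i : Fin d) : (k i : ℝ) ^ 2 ≤ freqSq k :=
  Finset.single_le_sum (f := fun i => (k i : ℝ) ^ 2) (fun _ _ => sq_nonneg _) (Finset.mem_univ i)

lemma freqSq_nonneg (k : Fin d → ℤ) : 0 ≤ freqSq k := Finset.sum_nonneg fun _ _ => sq_nonneg _

lemma freqSq_pos {k : Fin d → ℤ} (hk : k ≠ 0) : 0 < freqSq k := by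
  obtain ⟨i, hi⟩ := Function.ne_iff.1 hk
  refine lt_of_lt_of_le ?_ (sq_le_freqSq k i)
  have : (k i : ℝ) ≠ 0 := by exact_mod_cast hi
  positivity

lemma abs_mul_abs_le_freqSq (k : Fin d → ℤ) (i j : Fin d) :
    |(k i : ℝ)| * |(k j : ℝ)| ≤ freqSq k := by
  have h1 := sq_le_freqSq k i
  have h2 := sq_le_freqSq k j
  rw [← sq_abs] at h1 h2
  nlinarith [sq_nonneg (|(k i : ℝ)| - |(k j : ℝ)|)]

lemma MemHper2.coeffNorm_laplacian (h : MemHper2 f) (k : Fin d → ℤ) :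
    coeffNorm (weakLaplacian ⊤ f) k = 4 * Real.pi ^ 2 * freqSq k * coeffNorm f k := by
  have hint : ∀ i : Fin d, Integrable (Homog.weakDeriv ⊤ ![i, i] f) (volCube d) := fun i =>
    (h.weakDeriv le_rfl ![i, i]).2.2.integrable (by norm_num)
  have h1 : cosCoeff (weakLaplacian ⊤ f) k = -(4 * Real.pi ^ 2 * freqSq k) * cosCoeff f k := by
    have : cosCoeff (weakLaplacian ⊤ f) k =
        ∑ i, cosCoeff (Homog.weakDeriv ⊤ ![i, i] f) k := by
      simp only [cosCoeff, weakLaplacian, Finset.sum_mul]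
      exact integral_finsetSum _ fun i _ => integrable_mul_cos (hint i) k
    simp only [this, (h.isPeriodicDeriv₂ _ _).cosCoeff, (h.isPeriodicDeriv _).sinCoeff, freqSq,
      Finset.mul_sum, ← Finset.sum_neg_distrib, Finset.sum_mul]
    refine Finset.sum_congr rfl fun i _ => ?_
    ring
  have h2 : sinCoeff (weakLaplacian ⊤ f) k = -(4 * Real.pi ^ 2 * freqSq k) * sinCoeff f k := by
    have : sinCoeff (weakLaplacian ⊤ f) k =
        ∑ i, sinCoeff (Homog.weakDeriv ⊤ ![i, i] f) k := by
      simp only [sinCoeff, weakLaplacian, Finset.sum_mul]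
      exact integral_finsetSum _ fun i _ => integrable_mul_sin (hint i) k
    simp only [this, (h.isPeriodicDeriv₂ _ _).sinCoeff, (h.isPeriodicDeriv _).cosCoeff, freqSq,
      Finset.mul_sum, ← Finset.sum_neg_distrib, Finset.sum_mul]
    refine Finset.sum_congr rfl fun i _ => ?_
    ring
  have hn := freqSq_nonneg k
  have hp : 4 * Real.pi ^ 2 * freqSq k = √((4 * Real.pi ^ 2 * freqSq k) ^ 2) :=
    (Real.sqrt_sq (by positivity)).symm
  rw [coeffNorm, h1, h2, coeffNorm]
  conv_rhs => rw [hp]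
  rw [← Real.sqrt_mul (sq_nonneg _)]
  congr 1
  ring

lemma MemHper2.memLp_laplacian (h : MemHper2 f) : MemLp (weakLaplacian ⊤ f) 2 (volCube d) :=
  memLp_finsetSum _ fun i _ => (h.weakDeriv le_rfl ![i, i]).2.2

end Hper

/-- The lattice sum of ‖k‖⁻⁴ converges because the rank is less than four. The sup norm used for the
lattice is at most the Euclidean one, which is the direction needed. The zero frequency contributes
0 by the convention for the inverse. -/
lemma summable_freqSq_inv (hd : d < 4) : Summable fun k : Fin d → ℤ => (freqSq k)⁻¹ ^ 2 := by
  let b := Pi.basisFun ℝ (Fin d)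
  let L : Submodule ℤ (Fin d → ℝ) := Submodule.span ℤ (Set.range b)
  have hfr : Module.finrank ℤ L < 4 := by
    rw [Module.finrank_eq_card_basis (b.restrictScalars ℤ)]
    simpa using hd
  have hs := ZLattice.summable_norm_pow_inv L 4 hfr
  have hmem : ∀ k : Fin d → ℤ, (fun i => (k i : ℝ)) ∈ L := fun k => by
    have : (fun i => (k i : ℝ)) = ∑ i, k i • b i := by
      ext j
      simp [b, Finset.sum_apply, Pi.single_apply]
    rw [this]
    exact Submodule.sum_mem _ fun i _ =>
      Submodule.smul_mem _ _ (Submodule.subset_span (Set.mem_range_self i))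
  let e : (Fin d → ℤ) → L := fun k => ⟨fun i => (k i : ℝ), hmem k⟩
  have he : Function.Injective e := fun k k' h => by
    ext i
    have : (k i : ℝ) = k' i := congrFun (congrArg Subtype.val h) i
    exact_mod_cast this
  refine Summable.of_nonneg_of_le (fun k => by positivity) (fun k => ?_) (hs.comp_injective he)
  have hn : ‖e k‖ ^ 2 ≤ freqSq k := by
    change ‖fun i => (k i : ℝ)‖ ^ 2 ≤ freqSq k
    rw [← Real.le_sqrt (norm_nonneg _) (freqSq_nonneg k), pi_norm_le_iff_of_nonneg (Real.sqrt_nonneg _)]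
    exact fun i => Real.abs_le_sqrt (sq_le_freqSq k i)
  rcases eq_or_ne k 0 with rfl | hk
  · simp [freqSq]
  · have hpos : 0 < ‖e k‖ := by
      rw [norm_pos_iff]
      intro h0
      refine hk (he (h0.trans ?_))
      ext i
      simp [e]
    simp only [Function.comp]
    rw [show ‖e k‖⁻¹ ^ 4 = ((‖e k‖ ^ 2)⁻¹) ^ 2 by rw [← inv_pow, ← pow_mul]]
    have := freqSq_nonneg k
    gcongr

lemma summable_of_le_off_zero {u v : (Fin d → ℤ) → ℝ} (hu : ∀ k, 0 ≤ u k)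
    (h : ∀ k, k ≠ 0 → u k ≤ v k) (hv : Summable v) : Summable u := by
  refine Summable.of_norm_bounded_eventually hv ?_
  have : {x | ¬ ‖u x‖ ≤ v x} ⊆ {0} := fun k hk => by
    by_contra hne
    exact hk (by rw [Real.norm_of_nonneg (hu k)]; exact h k hne)
  exact (Set.finite_singleton _).subset this

/-- Away from k = 0 the coefficient of f is at most |k|⁻² times that of Δf, and a product is bounded
by the sum of squares. Both squares are summable: the first since Δf is in L², the second since d <
4. -/
lemma MemHper2.summable_coeffNorm (hd : d < 4) (h : MemHper2 f) : Summable (coeffNorm f) := by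
  have h1 := summable_coeff_sq h.memLp_laplacian
  refine summable_of_le_off_zero (coeffNorm_nonneg f) (fun k hk => ?_)
    (h1.add (summable_freqSq_inv hd))
  have hpos := freqSq_pos hk
  have e := h.coeffNorm_laplacian k
  have e2 : coeffNorm (weakLaplacian ⊤ f) k ^ 2 = cosCoeff (weakLaplacian ⊤ f) k ^ 2 +
      sinCoeff (weakLaplacian ⊤ f) k ^ 2 := Real.sq_sqrt (by positivity)
  rw [← e2]
  have h3 : coeffNorm f k * freqSq k ≤ coeffNorm (weakLaplacian ⊤ f) k := by
    rw [e]
    have hpi : (1 : ℝ) ≤ 4 * Real.pi ^ 2 := by nlinarith [Real.pi_gt_three]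
    nlinarith [mul_nonneg hpos.le (coeffNorm_nonneg f k)]
  have h4 : coeffNorm f k ≤ coeffNorm (weakLaplacian ⊤ f) k * (freqSq k)⁻¹ := by
    rwa [← div_eq_mul_inv, le_div_iff₀ hpos]
  nlinarith [sq_nonneg (coeffNorm (weakLaplacian ⊤ f) k - (freqSq k)⁻¹),
    sq_nonneg (coeffNorm (weakLaplacian ⊤ f) k + (freqSq k)⁻¹)]

lemma IsPeriodicDeriv.ae_bound (h : IsPeriodicDeriv j f g) (hs : Summable (Homog.coeffNorm g)) :
    ∃ M, 0 ≤ M ∧ ∀ᵐ y : Space d, |g y| ≤ M := by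
  obtain ⟨M, h0, hM⟩ := ae_bound_of_summable_coeff h.memLp' hs
  exact ⟨M, h0, h.per'.ae_bound hM⟩

lemma MemHper2.ae_bound (h : MemHper2 f) (hs : Summable (coeffNorm f)) :
    ∃ M, 0 ≤ M ∧ ∀ᵐ y : Space d, |f y| ≤ M := by
  obtain ⟨M, h0, hM⟩ := ae_bound_of_summable_coeff h.memLp hs
  exact ⟨M, h0, h.1.aePeriodic.ae_bound hM⟩

/-- The cell functions and the first derivatives of `γ` are bounded. -/
lemma exists_cell_bound (hd : d < 4) {a χ : Space d → ℝ} {γ : Fin d → Space d → ℝ}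
    (hχ : IsCellChi a χ) (hγ : IsCellGamma χ γ) :
    ∃ M, 0 ≤ M ∧ (∀ᵐ y : Space d, |χ y| ≤ M) ∧ (∀ i, ∀ᵐ y : Space d, |γ i y| ≤ M) ∧
      ∀ i j, ∀ᵐ y : Space d, |weakDeriv ⊤ ![j] (γ i) y| ≤ M := by
  have sχ := hχ.1.summable_coeffNorm hd
  -- Compare coefficients in -Δγ_i = 2∂_iχ: the moduli are 4π²|k|² times that of γ_i and 4π|k_i|
  -- times that of χ.
  have key : ∀ i k, Real.pi * freqSq k * coeffNorm (γ i) k = |(k i : ℝ)| * coeffNorm χ k := by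
    intro i k
    have h1 := (hγ i).1.coeffNorm_laplacian k
    have h2 : weakLaplacian ⊤ (γ i) =ᵐ[volume] fun y => (-2) * weakDeriv ⊤ ![i] χ y := by
      filter_upwards [(hγ i).2.2] with y hy
      linarith
    rw [coeffNorm_congr h2, coeffNorm_const_mul, (hχ.1.isPeriodicDeriv i).coeffNorm] at h1
    have h3 : Real.pi ≠ 0 := Real.pi_ne_zero
    rw [abs_neg, abs_two] at h1
    have : 4 * Real.pi * (Real.pi * freqSq k * coeffNorm (γ i) k) =
        4 * Real.pi * (|(k i : ℝ)| * coeffNorm χ k) := by linarith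
    exact mul_left_cancel₀ (by positivity) this
  have sγ : ∀ i, Summable (coeffNorm (γ i)) := fun i => (hγ i).1.summable_coeffNorm hd
  -- Membership of γ in H² alone would not suffice here. The coefficients of ∂_jγ_i are those of χ
  -- times 2|k_i k_j|/|k|², a multiplier bounded by 2, so absolute summability is inherited from χ.
  have sγ' : ∀ i j, Summable (coeffNorm (weakDeriv ⊤ ![j] (γ i))) := by
    intro i j
    refine summable_of_le_off_zero (coeffNorm_nonneg _) (fun k hk => ?_) (sχ.mul_left 2)
    have hpos := freqSq_pos hk
    have h1 := ((hγ i).1.isPeriodicDeriv j).coeffNorm k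
    have h2 := abs_mul_abs_le_freqSq k i j
    have h3 : freqSq k * coeffNorm (weakDeriv ⊤ ![j] (γ i)) k =
        2 * (|(k i : ℝ)| * |(k j : ℝ)|) * coeffNorm χ k := by
      rw [h1]
      linear_combination (2 * |(k j : ℝ)|) * key i k
    refine le_of_mul_le_mul_left ?_ hpos
    rw [h3]
    nlinarith [coeffNorm_nonneg χ k, mul_le_mul_of_nonneg_right h2 (coeffNorm_nonneg χ k)]
  obtain ⟨M1, p1, b1⟩ := hχ.1.ae_bound sχ
  choose M2 p2 b2 using fun i => (hγ i).1.ae_bound (sγ i)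
  choose M3 p3 b3 using fun i j => ((hγ i).1.isPeriodicDeriv j).ae_bound (sγ' i j)
  have q2 : 0 ≤ ∑ i, M2 i := Finset.sum_nonneg fun i _ => p2 i
  have q3 : 0 ≤ ∑ i, ∑ j, M3 i j := Finset.sum_nonneg fun i _ => Finset.sum_nonneg fun j _ => p3 i j
  refine ⟨M1 + ∑ i, M2 i + ∑ i, ∑ j, M3 i j, by positivity, ?_, fun i => ?_, fun i j => ?_⟩
  · filter_upwards [b1] with y hy
    linarith
  · have := Finset.single_le_sum (f := M2) (fun i _ => p2 i) (Finset.mem_univ i)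
    filter_upwards [b2 i] with y hy
    linarith
  · have h1 := Finset.single_le_sum (f := fun i => ∑ j, M3 i j)
      (fun i _ => Finset.sum_nonneg fun j _ => p3 i j) (Finset.mem_univ i)
    have h2 := Finset.single_le_sum (f := M3 i) (fun j _ => p3 i j) (Finset.mem_univ j)
    filter_upwards [b3 i j] with y hy
    linarith

end Coeff


/-! ### The product rule for oscillating functions -/

section Leibniz

variable {d : ℕ} {D : Opens (Space d)}

/-- Rests on the identity q ∂²φ = ∂²(qφ) - 2∂(q₁φ) + q₂φ, in which every derivative falls on a test
function and can be moved to G. -/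
lemma integral_mul_smooth_mul_testDeriv₂ {G q q₁ q₂ : Space d → ℝ} {i : Fin d} (hG : MemH D 2 G)
    (hq : ContDiff ℝ (⊤ : ℕ∞) q) (hq₁ : ContDiff ℝ (⊤ : ℕ∞) q₁) (hq₂ : ContDiff ℝ (⊤ : ℕ∞) q₂)
    (e₁ : ∀ x, fderiv ℝ q x (stdVec i) = q₁ x) (e₂ : ∀ x, fderiv ℝ q₁ x (stdVec i) = q₂ x)
    (φ : 𝓓(D, ℝ)) :
    ∫ x in (D : Set (Space d)), G x * (q x * testDeriv ![i, i] φ x) =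
      (∫ x in (D : Set (Space d)), weakDeriv D ![i, i] G x * (q x * φ x)) +
      2 * (∫ x in (D : Set (Space d)), weakDeriv D ![i] G x * (q₁ x * φ x)) +
      ∫ x in (D : Set (Space d)), G x * (q₂ x * φ x) := by
  have h1 := (hG.weakDeriv le_rfl ![i, i]).1.integral_eq (smoothMul q hq φ)
  have h2 := (hG.weakDeriv (by norm_num) ![i]).1.integral_eq (smoothMul q₁ hq₁ φ)
  have hl := locallyIntegrableOn_of_memLp hG.memLp
  have i1 := integrable_mul_test hl (testDeriv ![i, i] (smoothMul q hq φ))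
  have i2 := integrable_mul_test hl (testDeriv ![i] (smoothMul q₁ hq₁ φ))
  have i3 := integrable_mul_test hl (smoothMul q₂ hq₂ φ)
  have e3 : ∀ x, testDeriv ![i] (smoothMul q₁ hq₁ φ) x =
      q₁ x * testDeriv ![i] φ x + q₂ x * φ x := fun x => by
    rw [testDeriv_smoothMul, e₂]
  have e4 : ∀ x, testDeriv ![i, i] (smoothMul q hq φ) x =
      q x * testDeriv ![i, i] φ x + 2 * (q₁ x * testDeriv ![i] φ x) + q₂ x * φ x := fun x => by
    have a1 : testDeriv ![i] (smoothMul q hq φ) =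
        smoothMul q hq (testDeriv ![i] φ) + smoothMul q₁ hq₁ φ := by
      ext y
      rw [testDeriv_smoothMul, e₁]
      rfl
    have a2 : testDeriv ![i, i] (smoothMul q hq φ) =
        testDeriv ![i] (smoothMul q hq (testDeriv ![i] φ)) + testDeriv ![i] (smoothMul q₁ hq₁ φ) := by
      change testDeriv ![i] (testDeriv ![i] (smoothMul q hq φ)) = _
      rw [a1]
      exact LineDeriv.lineDerivOp_add _ _ _
    rw [a2]
    change testDeriv ![i] (smoothMul q hq (testDeriv ![i] φ)) x +
      testDeriv ![i] (smoothMul q₁ hq₁ φ) x = _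
    rw [e3, testDeriv_smoothMul, e₁]
    change q x * testDeriv ![i, i] φ x + _ + _ = _
    ring
  have key : ∫ x in (D : Set (Space d)), G x * (q x * testDeriv ![i, i] φ x) =
      (∫ x in (D : Set (Space d)), G x * testDeriv ![i, i] (smoothMul q hq φ) x) -
      2 * (∫ x in (D : Set (Space d)), G x * testDeriv ![i] (smoothMul q₁ hq₁ φ) x) +
      ∫ x in (D : Set (Space d)), G x * smoothMul q₂ hq₂ φ x := by
    have i4 := i1.sub (i2.const_mul 2)
    simp only [Pi.sub_def] at i4
    rw [← integral_const_mul, ← integral_sub i1 (i2.const_mul 2), ← integral_add i4 i3]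
    refine integral_congr_ae (ae_of_all _ fun x => ?_)
    simp only [e3, e4, smoothMul_apply]
    ring
  rw [key, h1, h2]
  simp only [smoothMul_apply]
  ring

lemma fderiv_osc {F : Space d → ℝ} (hF : Differentiable ℝ F) (ε : ℝ) (x v : Space d) :
    fderiv ℝ (osc ε F) x v = ε⁻¹ * fderiv ℝ F (ε⁻¹ • x) v := by
  have h : HasFDerivAt (osc ε F) ((fderiv ℝ F (ε⁻¹ • x)).comp
      (ε⁻¹ • ContinuousLinearMap.id ℝ (Space d))) x :=
    (hF _).hasFDerivAt.comp x ((hasFDerivAt_id x).const_smul ε⁻¹)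
  rw [h.fderiv]
  simp

lemma contDiff_osc {F : Space d → ℝ} (hF : ContDiff ℝ (⊤ : ℕ∞) F) (ε : ℝ) :
    ContDiff ℝ (⊤ : ℕ∞) (osc ε F) :=
  hF.comp (contDiff_id.const_smul ε⁻¹)

variable {ε : ℝ} {F G : Space d → ℝ}

lemma memLp_osc (hD : Bornology.IsBounded (D : Set (Space d))) (hε : 0 < ε)
    (hF : AEPeriodic F) (hm : AEStronglyMeasurable F volume) (hL : MemLp F 2 (volCube d)) :
    MemLp (osc ε F) 2 (volOn D) := by
  obtain ⟨K, hK, h⟩ := exists_eLpNorm_osc_le hD hε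
  exact ⟨(aestronglyMeasurable_osc hε hm).restrict,
    (h F hF).trans_lt (ENNReal.mul_lt_top hK.lt_top hL.2)⟩

lemma exists_abs_test_le (φ : 𝓓(D, ℝ)) : ∃ C, 0 ≤ C ∧ ∀ x, |φ x| ≤ C := by
  obtain ⟨C, hC⟩ := φ.hasCompactSupport.exists_bound_of_continuous φ.continuous
  exact ⟨C, (norm_nonneg _).trans (hC 0), hC⟩

/-- The product φG is in L²(D), and the rescaled truncation error tends to zero in L²(D) because it
is controlled by the error over the cell. -/
lemma tendsto_integral_osc_fourierSum (hD : Bornology.IsBounded (D : Set (Space d))) (hε : 0 < ε)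
    (hF : AEPeriodic F) (hm : AEStronglyMeasurable F volume) (hL : MemLp F 2 (volCube d))
    (hG : MemLp G 2 (volOn D)) (φ : 𝓓(D, ℝ)) :
    Filter.Tendsto
      (fun S => ∫ x in (D : Set (Space d)), G x * (osc ε (fourierSum S F) x * φ x))
      Filter.atTop (nhds (∫ x in (D : Set (Space d)), G x * (osc ε F x * φ x))) := by
  obtain ⟨K, hK, h⟩ := exists_eLpNorm_osc_le hD hε
  obtain ⟨C, -, hC⟩ := exists_abs_test_le φ
  have hGφ : MemLp (fun x => φ x * G x) 2 (volOn D) :=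
    memLp_bdd_mul φ.continuous.aestronglyMeasurable (ae_of_all _ hC) hG
  have hoF := memLp_osc hD hε hF hm hL
  have hoS : ∀ S, MemLp (osc ε (fourierSum S F)) 2 (volOn D) := fun S => by
    refine memLp_osc hD hε (aePeriodic_fourierSum S F)
      (continuous_fourierSum S F).aestronglyMeasurable ?_
    unfold fourierSum
    refine memLp_finsetSum S fun k _ => ?_
    refine MemLp.of_bound (by fun_prop) (|cosCoeff F k| + |sinCoeff F k|)
      (ae_of_all _ fun y => ?_)
    refine (norm_add_le _ _).trans ?_
    rw [norm_mul, norm_mul]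
    exact add_le_add (mul_le_of_le_one_right (norm_nonneg _) (Real.abs_cos_le_one _))
      (mul_le_of_le_one_right (norm_nonneg _) (Real.abs_sin_le_one _))
  have h0 := tendsto_eLpNorm_fourierSum hL
  have h1 : Filter.Tendsto (fun S => eLpNorm (osc ε (fourierSum S F - F)) 2 (volOn D))
      Filter.atTop (nhds 0) := by
    refine tendsto_of_tendsto_of_tendsto_of_le_of_le tendsto_const_nhds ?_ (fun _ => zero_le)
      fun S => h _ ((aePeriodic_fourierSum S F).sub hF)
    simpa using ENNReal.Tendsto.const_mul h0 (Or.inr hK)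
  have h2 : Filter.Tendsto (fun S => l2norm (volOn D) (osc ε (fourierSum S F - F)))
      Filter.atTop (nhds 0) := by
    simpa [l2norm, Function.comp_def] using (ENNReal.tendsto_toReal ENNReal.zero_ne_top).comp h1
  rw [tendsto_iff_dist_tendsto_zero]
  refine tendsto_of_tendsto_of_tendsto_of_le_of_le tendsto_const_nhds
    (by simpa using h2.const_mul (l2norm (volOn D) fun x => φ x * G x)) (fun _ => dist_nonneg)
    fun S => ?_
  have e : ∀ (Q : Space d → ℝ), ∫ x in (D : Set (Space d)), G x * (Q x * φ x) =
      ∫ x in (D : Set (Space d)), (φ x * G x) * Q x := fun Q =>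
    integral_congr_ae (ae_of_all _ fun x => by ring)
  have i1 := integrable_mul_of_memLp_two hGφ (hoS S)
  have i2 := integrable_mul_of_memLp_two hGφ hoF
  rw [Real.dist_eq, e, e, ← integral_sub i1 i2]
  refine le_trans (le_of_eq ?_) (abs_integral_mul_le_l2norm hGφ ((hoS S).sub hoF))
  congr 1
  refine integral_congr_ae (ae_of_all _ fun x => ?_)
  simp only [osc, Pi.sub_apply]
  ring

/-- The second derivatives of a product of an oscillating function and a function in `H²(D)`. -/
lemma hasWeakDeriv_osc_mul (hD : Bornology.IsBounded (D : Set (Space d))) (hε : 0 < ε)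
    {f : Space d → ℝ} (hf : MemHper2 f) (hG : MemH D 2 G) (i : Fin d) :
    HasWeakDeriv D ![i, i] (fun x => osc ε f x * G x) fun x =>
      osc ε f x * weakDeriv D ![i, i] G x +
      2 * ε⁻¹ * (osc ε (weakDeriv ⊤ ![i] f) x * weakDeriv D ![i] G x) +
      ε⁻¹ ^ 2 * (osc ε (weakDeriv ⊤ ![i, i] f) x * G x) := by
  have p1 := hf.isPeriodicDeriv i
  have p2 := hf.isPeriodicDeriv₂ i i
  have m0 := (locallyIntegrable_of_top p1.deriv.1).aestronglyMeasurable
  have m1 := (locallyIntegrable_of_top p2.deriv.1).aestronglyMeasurable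
  have m2 := (locallyIntegrable_of_top p2.deriv.2.1).aestronglyMeasurable
  have o0 := memLp_osc hD hε p1.per m0 p1.memLp
  have o1 := memLp_osc hD hε p2.per m1 p2.memLp
  have o2 := memLp_osc hD hε p2.per' m2 p2.memLp'
  have g0 := hG.memLp
  have g1 := (hG.weakDeriv (by norm_num) ![i]).2
  have g2 := (hG.weakDeriv le_rfl ![i, i]).2
  -- A product of two L² functions is only known to be in L¹; that is enough for a weak derivative.
  have loc : ∀ {u v : Space d → ℝ}, MemLp u 2 (volOn D) → MemLp v 2 (volOn D) →
      LocallyIntegrableOn (fun x => u x * v x) D volume := fun hu hv =>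
    (show IntegrableOn _ _ _ from integrable_mul_of_memLp_two hu hv).locallyIntegrableOn
  have l1 := loc o0 g2
  have l2 := (loc o1 g1).smul (2 * ε⁻¹)
  have l3 := (loc o2 g0).smul (ε⁻¹ ^ 2)
  refine hasWeakDeriv_iff.2 ⟨loc o0 g0, (l1.add l2).add l3, fun φ => ?_⟩
  have t0 := tendsto_integral_osc_fourierSum hD hε p1.per m0 p1.memLp g0 (testDeriv ![i, i] φ)
  have t1 := tendsto_integral_osc_fourierSum hD hε p1.per m0 p1.memLp g2 φ
  have t2 := tendsto_integral_osc_fourierSum hD hε p2.per m1 p2.memLp g1 φ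
  have t3 := tendsto_integral_osc_fourierSum hD hε p2.per' m2 p2.memLp' g0 φ
  -- The product rule for each trigonometric polynomial; all four integrals converge as the
  -- truncation set grows.
  have e : ∀ S, ∫ x in (D : Set (Space d)), G x * (osc ε (fourierSum S f) x *
        testDeriv ![i, i] φ x) =
      (∫ x in (D : Set (Space d)), weakDeriv D ![i, i] G x * (osc ε (fourierSum S f) x * φ x)) +
      2 * ε⁻¹ * (∫ x in (D : Set (Space d)), weakDeriv D ![i] G x *
        (osc ε (fourierSum S (weakDeriv ⊤ ![i] f)) x * φ x)) +
      ε⁻¹ ^ 2 * ∫ x in (D : Set (Space d)), G x *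
        (osc ε (fourierSum S (weakDeriv ⊤ ![i, i] f)) x * φ x) := by
    intro S
    have hs : ∀ F : Space d → ℝ, ContDiff ℝ (⊤ : ℕ∞) (osc ε (fourierSum S F)) := fun F =>
      contDiff_osc (contDiff_fourierSum S F) ε
    have hd : ∀ F : Space d → ℝ, Differentiable ℝ (fourierSum S F) := fun F =>
      (contDiff_fourierSum S F).differentiable (by simp)
    have e1 : ∀ x, fderiv ℝ (osc ε (fourierSum S f)) x (stdVec i) =
        ε⁻¹ * osc ε (fourierSum S (weakDeriv ⊤ ![i] f)) x := fun x => by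
      rw [fderiv_osc (hd _), p1.fderiv_fourierSum]; rfl
    have e2 : ∀ x, fderiv ℝ (fun x => ε⁻¹ * osc ε (fourierSum S (weakDeriv ⊤ ![i] f)) x) x
        (stdVec i) = ε⁻¹ ^ 2 * osc ε (fourierSum S (weakDeriv ⊤ ![i, i] f)) x := fun x => by
      rw [fderiv_const_mul ((hs _).differentiable (by simp) x), smul_apply, fderiv_osc (hd _),
        p2.fderiv_fourierSum, smul_eq_mul]
      simp only [osc]
      ring
    rw [integral_mul_smooth_mul_testDeriv₂ hG (hs _) (contDiff_const.mul (hs _))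
      (contDiff_const.mul (hs _)) e1 e2 φ]
    rw [mul_assoc 2 ε⁻¹, ← integral_const_mul ε⁻¹, ← integral_const_mul (ε⁻¹ ^ 2)]
    congr 1
    · congr 2
      exact integral_congr_ae (ae_of_all _ fun x => by ring)
    · exact integral_congr_ae (ae_of_all _ fun x => by ring)
  have t4 := (t1.add (t2.const_mul (2 * ε⁻¹))).add (t3.const_mul (ε⁻¹ ^ 2))
  have lim := tendsto_nhds_unique (t0.congr e) t4
  have j1 := integrable_mul_test l1 φ
  have j2 := integrable_mul_test l2 φ
  have j3 := integrable_mul_test l3 φ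
  have r : ∫ x in (D : Set (Space d)), (osc ε f x * weakDeriv D ![i, i] G x +
      2 * ε⁻¹ * (osc ε (weakDeriv ⊤ ![i] f) x * weakDeriv D ![i] G x) +
      ε⁻¹ ^ 2 * (osc ε (weakDeriv ⊤ ![i, i] f) x * G x)) * φ x =
      (∫ x in (D : Set (Space d)), weakDeriv D ![i, i] G x * (osc ε f x * φ x)) +
      2 * ε⁻¹ * (∫ x in (D : Set (Space d)), weakDeriv D ![i] G x *
        (osc ε (weakDeriv ⊤ ![i] f) x * φ x)) +
      ε⁻¹ ^ 2 * ∫ x in (D : Set (Space d)), G x *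
        (osc ε (weakDeriv ⊤ ![i, i] f) x * φ x) := by
    rw [← integral_const_mul, ← integral_const_mul, ← integral_add, ← integral_add]
    · exact integral_congr_ae (ae_of_all _ fun x => by ring)
    · refine (j1.add j2).congr (ae_of_all _ fun x => ?_)
      simp only [Pi.add_apply, Pi.smul_apply, smul_eq_mul]
      ring
    · refine j3.congr (ae_of_all _ fun x => ?_)
      simp only [Pi.smul_apply, smul_eq_mul]
      ring
    · refine j1.congr (ae_of_all _ fun x => ?_)
      ring
    · refine j2.congr (ae_of_all _ fun x => ?_)
      simp only [Pi.smul_apply, smul_eq_mul]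
      ring
  rw [r, ← lim, neg_one_sq, one_mul]
  exact integral_congr_ae (ae_of_all _ fun x => by ring)

end Leibniz


/-! ### The space `H²₀(D)` and the energy estimate -/

section Energy

variable {d : ℕ} {D : Opens (Space d)} {f g v : Space d → ℝ} {k : ℕ} {N N' τ : ℝ}

lemma MemHB.sub (hf : MemHB D k f N) (hg : MemHB D k g N') :
    MemHB D k (fun x => f x - g x) (N + N') := by
  have := hf.add (hg.const_mul (-1))
  rw [abs_neg, abs_one, one_mul] at this
  simpa [sub_eq_add_neg] using this

lemma MemH.sub (hf : MemH D k f) (hg : MemH D k g) : MemH D k (fun x => f x - g x) :=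
  (hf.memHB.sub hg.memHB).memH

lemma MemHB.normH_le (h : MemHB D k f N) :
    normH D k f ≤ √(∑ m ∈ Finset.range (k + 1), (d : ℝ) ^ m) * N := by
  have hN : 0 ≤ N := (l2norm_nonneg _).trans h.memLp.2
  rw [← Real.sqrt_sq hN, ← Real.sqrt_mul (Finset.sum_nonneg fun _ _ => by positivity),
    ← Real.sqrt_sq (normH_nonneg (D := D) (k := k) (f := f)), normH_sq h.memH]
  refine Real.sqrt_le_sqrt ?_
  rw [Finset.sum_mul]
  refine Finset.sum_le_sum fun m hm => ?_
  have : ∀ w ∈ (Finset.univ : Finset (Fin m → Fin d)),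
      l2norm (volOn D) (Homog.weakDeriv D w f) ^ 2 ≤ N ^ 2 := fun w _ => by
    have := (h.weakDeriv (Nat.lt_succ_iff.1 (Finset.mem_range.1 hm)) w).2.2
    have h0 := l2norm_nonneg (μ := volOn D) (Homog.weakDeriv D w f)
    gcongr
  refine (Finset.sum_le_sum this).trans_eq ?_
  simp

/-- Replaces the Sobolev norm by a bound on each derivative separately, for which sums and multiples
are immediate. In the converse the loss is the square root of the number of words of length at most
two. -/
lemma memH20_iff : MemH20 D f ↔
    MemH D 2 f ∧ ∀ δ > 0, ∃ φ : 𝓓(D, ℝ), MemHB D 2 (fun x => f x - φ x) δ := by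
  refine and_congr_right fun hf => ⟨fun h δ hδ => ?_, fun h δ hδ => ?_⟩
  · obtain ⟨φ, hφ⟩ := h δ hδ
    refine ⟨φ, fun m hm w => ?_⟩
    obtain ⟨u, h1, h2, h3⟩ := (hf.sub (memH_test φ)).memHB m hm w
    exact ⟨u, h1, h2, h3.trans hφ.le⟩
  · set c := √(∑ m ∈ Finset.range (2 + 1), (d : ℝ) ^ m)
    have hc : 0 ≤ c := Real.sqrt_nonneg _
    obtain ⟨φ, hφ⟩ := h (δ / (c + 1)) (by positivity)
    refine ⟨φ, hφ.normH_le.trans_lt ?_⟩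
    rw [mul_div_assoc', div_lt_iff₀ (by positivity)]
    nlinarith

lemma MemH20.add (hf : MemH20 D f) (hg : MemH20 D g) : MemH20 D fun x => f x + g x := by
  rw [memH20_iff] at *
  refine ⟨hf.1.add hg.1, fun δ hδ => ?_⟩
  obtain ⟨φ, hφ⟩ := hf.2 (δ / 2) (by positivity)
  obtain ⟨ψ, hψ⟩ := hg.2 (δ / 2) (by positivity)
  refine ⟨φ + ψ, ?_⟩
  have := hφ.add hψ
  rw [add_halves] at this
  convert this using 2
  change _ - (φ _ + ψ _) = _
  ring

lemma MemH20.const_mul (c : ℝ) (hf : MemH20 D f) : MemH20 D fun x => c * f x := by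
  rw [memH20_iff] at *
  refine ⟨hf.1.const_mul c, fun δ hδ => ?_⟩
  obtain ⟨φ, hφ⟩ := hf.2 (δ / (|c| + 1)) (by positivity)
  refine ⟨c • φ, fun m hm w => ?_⟩
  obtain ⟨u, h1, h2, h3⟩ := hφ.const_mul c m hm w
  refine ⟨u, ?_, h2, h3.trans ?_⟩
  · convert h1 using 2
    change _ - c * φ _ = _
    ring
  · rw [mul_div_assoc', div_le_iff₀ (by positivity)]
    nlinarith [abs_nonneg c]

lemma weakLaplacian_add (hf : MemH D 2 f) (hg : MemH D 2 g) :
    weakLaplacian D (fun x => f x + g x) =ᵐ[volOn D]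
      fun x => weakLaplacian D f x + weakLaplacian D g x := by
  have : ∀ᵐ x ∂volOn D, ∀ i, weakDeriv D ![i, i] (fun x => f x + g x) x =
      weakDeriv D ![i, i] f x + weakDeriv D ![i, i] g x := ae_all_iff.2 fun i =>
    ((hf.weakDeriv le_rfl ![i, i]).1.add (hg.weakDeriv le_rfl ![i, i]).1).weakDeriv_ae_eq
  filter_upwards [this] with x hx
  simp only [weakLaplacian, hx, Finset.sum_add_distrib]

lemma weakLaplacian_const_mul (c : ℝ) (hf : MemH D 2 f) :
    weakLaplacian D (fun x => c * f x) =ᵐ[volOn D] fun x => c * weakLaplacian D f x := by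
  have : ∀ᵐ x ∂volOn D, ∀ i, weakDeriv D ![i, i] (fun x => c * f x) x =
      c * weakDeriv D ![i, i] f x := ae_all_iff.2 fun i =>
    ((hf.weakDeriv le_rfl ![i, i]).1.const_mul c).weakDeriv_ae_eq
  filter_upwards [this] with x hx
  simp only [weakLaplacian, hx, Finset.mul_sum]

lemma weakLaplacian_test (φ : 𝓓(D, ℝ)) : weakLaplacian D φ =ᵐ[volOn D] testLap φ := by
  have : ∀ᵐ x ∂volOn D, ∀ i, weakDeriv D ![i, i] φ x = testDeriv ![i, i] φ x :=
    ae_all_iff.2 fun i => (hasWeakDeriv_test ![i, i] φ).weakDeriv_ae_eq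
  filter_upwards [this] with x hx
  simp only [weakLaplacian, hx, testLap_apply]

lemma shiftedLaplacian_add (hf : MemH D 2 f) (hg : MemH D 2 g) :
    shiftedLaplacian D τ (fun x => f x + g x) =ᵐ[volOn D]
      fun x => shiftedLaplacian D τ f x + shiftedLaplacian D τ g x := by
  filter_upwards [weakLaplacian_add hf hg] with x hx
  simp only [shiftedLaplacian, hx]
  ring

lemma shiftedLaplacian_const_mul (c : ℝ) (hf : MemH D 2 f) :
    shiftedLaplacian D τ (fun x => c * f x) =ᵐ[volOn D]
      fun x => c * shiftedLaplacian D τ f x := by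
  filter_upwards [weakLaplacian_const_mul c hf] with x hx
  simp only [shiftedLaplacian, hx]
  ring

lemma shiftedLaplacian_sub (hf : MemH D 2 f) (hg : MemH D 2 g) :
    shiftedLaplacian D τ (fun x => f x - g x) =ᵐ[volOn D]
      fun x => shiftedLaplacian D τ f x - shiftedLaplacian D τ g x := by
  have e : (fun x => f x - g x) = fun x => f x + (-1) * g x := by ext; ring
  rw [e]
  filter_upwards [shiftedLaplacian_add (τ := τ) hf (hg.const_mul (-1)),
    shiftedLaplacian_const_mul (τ := τ) (-1) hg] with x h1 h2
  rw [h1, h2]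
  ring

lemma MemH.memLp_shiftedLaplacian (hτ : 0 ≤ τ) (hf : MemH D 2 f) :
    MemLp (shiftedLaplacian D τ f) 2 (volOn D) :=
  (MemHB.shiftedLaplacian (k := 0) hτ hf.memHB).memLp.1

/-- The energy estimate for functions in `H²₀(D)`, whose energy form is represented by `L²`
functions. -/
lemma energy_estimate {b R S : Space d → ℝ} {a₀ M : ℝ} (hτ : 0 < τ) (ha₀ : 0 < a₀)
    (hv : MemH20 D v) (hb : AEStronglyMeasurable b (volOn D)) (hb₀ : ∀ᵐ x ∂volOn D, a₀ ≤ b x)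
    (hbM : ∀ᵐ x ∂volOn D, |b x| ≤ M) (hR : MemLp R 2 (volOn D)) (hS : MemLp S 2 (volOn D))
    (h : ∀ φ : 𝓓(D, ℝ),
      (∫ x in (D : Set (Space d)), (b x * shiftedLaplacian D τ v x - R x) *
        (testLap φ x + τ * φ x)) +
      ∫ x in (D : Set (Space d)), (τ ^ 2 * v x - S x) * φ x = 0) :
    normH20 D v ≤ 2 * (1 + τ) / min a₀ (τ ^ 2) * (l2norm (volOn D) R + l2norm (volOn D) S) := by
  rw [memH20_iff] at hv
  obtain ⟨hv2, hvφ⟩ := hv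
  have hvL := hv2.memLp
  have hsL := hv2.memLp_shiftedLaplacian hτ.le
  set s := shiftedLaplacian D τ v with hs
  have hbs := memLp_bdd_mul hb hbM hsL
  have hp : MemLp (fun x => b x * s x - R x) 2 (volOn D) := hbs.sub hR
  have hq : MemLp (fun x => τ ^ 2 * v x - S x) 2 (volOn D) := (hvL.const_mul _).sub hS
  set p := fun x => b x * s x - R x with hpdef
  set q := fun x => τ ^ 2 * v x - S x with hqdef
  have hT : (∫ x in (D : Set (Space d)), p x * s x) +
      ∫ x in (D : Set (Space d)), q x * v x = 0 := by
    set T := (∫ x in (D : Set (Space d)), p x * s x) + ∫ x in (D : Set (Space d)), q x * v x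
    set K := l2norm (volOn D) p * (d + τ) + l2norm (volOn D) q with hK
    have hK0 : 0 ≤ K := by
      have := l2norm_nonneg (μ := volOn D) p
      have := l2norm_nonneg (μ := volOn D) q
      positivity
    -- Density: T vanishes with the test function φ in the second slot, so T equals the same
    -- expression with v - φ there, and φ is δ-close to v in H².
    have bound : ∀ δ > 0, |T| ≤ K * δ := by
      intro δ hδ
      obtain ⟨φ, hφ⟩ := hvφ δ hδ
      have hw := MemHB.shiftedLaplacian (k := 0) hτ.le hφ
      have e1 : shiftedLaplacian D τ (fun x => v x - φ x) =ᵐ[volOn D]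
          fun x => s x - (testLap φ x + τ * φ x) := by
        filter_upwards [shiftedLaplacian_sub (τ := τ) hv2 (memH_test φ), weakLaplacian_test φ]
          with x h1 h2
        rw [h1]
        simp only [shiftedLaplacian, h2, hs]
      have hw' := hw.congr_ae e1
      have hφL : MemLp (fun x => testLap φ x + τ * φ x) 2 (volOn D) :=
        (memLp_test _).add ((memLp_test φ).const_mul τ)
      have eT : T = (∫ x in (D : Set (Space d)), p x * (s x - (testLap φ x + τ * φ x))) +
          ∫ x in (D : Set (Space d)), q x * (v x - φ x) := by
        simp only [mul_sub]
        rw [integral_sub (integrable_mul_of_memLp_two hp hsL)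
          (integrable_mul_of_memLp_two hp hφL), integral_sub (integrable_mul_of_memLp_two hq hvL)
          (integrable_mul_of_memLp_two hq (memLp_test φ))]
        have := h φ
        simp only [T]
        linarith
      rw [eT]
      refine (abs_add_le _ _).trans ?_
      refine (add_le_add (abs_integral_mul_le_l2norm hp hw'.memLp.1)
        (abs_integral_mul_le_l2norm hq hφ.memLp.1)).trans ?_
      have h1 := mul_le_mul_of_nonneg_left hw'.memLp.2 (l2norm_nonneg (μ := volOn D) p)
      have h2 := mul_le_mul_of_nonneg_left hφ.memLp.2 (l2norm_nonneg (μ := volOn D) q)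
      rw [hK]
      linarith
    by_contra hne
    have hpos : 0 < |T| := abs_pos.2 hne
    have := bound (|T| / (2 * (K + 1))) (by positivity)
    rw [mul_div_assoc', le_div_iff₀ (by positivity)] at this
    nlinarith
  have e1 : ∫ x in (D : Set (Space d)), p x * s x =
      (∫ x in (D : Set (Space d)), b x * s x * s x) - ∫ x in (D : Set (Space d)), R x * s x := by
    rw [← integral_sub (integrable_mul_of_memLp_two hbs hsL) (integrable_mul_of_memLp_two hR hsL)]
    exact integral_congr_ae (ae_of_all _ fun x => by simp only [hpdef]; ring)
  have e2 : ∫ x in (D : Set (Space d)), q x * v x =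
      τ ^ 2 * (∫ x in (D : Set (Space d)), v x * v x) -
        ∫ x in (D : Set (Space d)), S x * v x := by
    rw [← integral_const_mul, ← integral_sub ((integrable_mul_of_memLp_two hvL hvL).const_mul _)
      (integrable_mul_of_memLp_two hS hvL)]
    exact integral_congr_ae (ae_of_all _ fun x => by simp only [hqdef]; ring)
  set X := l2norm (volOn D) s with hX
  set Z := l2norm (volOn D) v with hZ
  set ρ := l2norm (volOn D) R
  set σ := l2norm (volOn D) S
  have hX0 : 0 ≤ X := l2norm_nonneg _
  have hZ0 : 0 ≤ Z := l2norm_nonneg _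
  have hρ0 : 0 ≤ ρ := l2norm_nonneg _
  have hσ0 : 0 ≤ σ := l2norm_nonneg _
  have l1 : a₀ * X ^ 2 ≤ ∫ x in (D : Set (Space d)), b x * s x * s x := by
    rw [hX, ← integral_sq_eq_l2norm_sq hsL, ← integral_const_mul]
    refine integral_mono_ae (hsL.integrable_sq.const_mul a₀)
      (integrable_mul_of_memLp_two hbs hsL) ?_
    filter_upwards [hb₀] with x hx
    nlinarith [sq_nonneg (s x)]
  have l2 : ∫ x in (D : Set (Space d)), v x * v x = Z ^ 2 := by
    rw [hZ, ← integral_sq_eq_l2norm_sq hvL]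
    exact integral_congr_ae (ae_of_all _ fun x => by ring)
  have l3 : ∫ x in (D : Set (Space d)), R x * s x ≤ ρ * X :=
    (le_abs_self _).trans (abs_integral_mul_le_l2norm hR hsL)
  have l4 : ∫ x in (D : Set (Space d)), S x * v x ≤ σ * Z :=
    (le_abs_self _).trans (abs_integral_mul_le_l2norm hS hvL)
  rw [e1, e2, l2] at hT
  have main : a₀ * X ^ 2 + τ ^ 2 * Z ^ 2 ≤ ρ * X + σ * Z := by linarith
  set m := min a₀ (τ ^ 2) with hm
  have hm0 : 0 < m := lt_min ha₀ (by positivity)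
  -- Coercivity gives m(X + Z)² ≤ 2(a₀X² + τ²Z²) ≤ 2(ρ + σ)(X + Z); then X + Z is divided out.
  have hXZ : X + Z ≤ 2 * (ρ + σ) / m := by
    rw [le_div_iff₀ hm0]
    by_contra hc
    push Not at hc
    have hpos : 0 < X + Z := by
      by_contra hle
      have : (X + Z) * m ≤ 0 := mul_nonpos_of_nonpos_of_nonneg (not_lt.1 hle) hm0.le
      linarith
    have h1 : m * X ^ 2 ≤ a₀ * X ^ 2 := by gcongr; exact min_le_left _ _
    have h2 : m * Z ^ 2 ≤ τ ^ 2 * Z ^ 2 := by gcongr; exact min_le_right _ _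
    have h3 : m * (X + Z) ^ 2 ≤ 2 * (m * X ^ 2 + m * Z ^ 2) := by
      nlinarith [mul_nonneg hm0.le (sq_nonneg (X - Z))]
    have h4 : ρ * X + σ * Z ≤ (ρ + σ) * (X + Z) := by
      nlinarith [mul_nonneg hρ0 hZ0, mul_nonneg hσ0 hX0]
    have h5 := mul_lt_mul_of_pos_right hc hpos
    nlinarith
  have hlap : normH20 D v ≤ X + τ * Z := by
    have hw : MemLp (weakLaplacian D v) 2 (volOn D) := (MemHB.laplacian (k := 0) hv2.memHB).memLp.1
    rw [normH20, integral_sq_eq_l2norm_sq hw, Real.sqrt_sq (l2norm_nonneg _)]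
    have e : weakLaplacian D v = s - fun x => τ * v x := by
      ext x
      simp [hs, shiftedLaplacian]
    rw [e]
    refine (l2norm_sub_le hsL (hvL.const_mul τ)).trans_eq ?_
    rw [l2norm_const_mul, abs_of_pos hτ]
  calc normH20 D v ≤ X + τ * Z := hlap
    _ ≤ (1 + τ) * (X + Z) := by nlinarith [mul_nonneg hτ.le hX0]
    _ ≤ (1 + τ) * (2 * (ρ + σ) / m) := by gcongr
    _ = 2 * (1 + τ) / m * (ρ + σ) := by ring

end Energy


/-! ### The expansion -/

section Expansion

variable {d : ℕ} {D : Opens (Space d)} {ε τ : ℝ}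

lemma weakLaplacian_of_hasWeakDeriv {f : Space d → ℝ} {L : Fin d → Space d → ℝ}
    (h : ∀ j, HasWeakDeriv D ![j, j] f (L j)) :
    weakLaplacian D f =ᵐ[volOn D] fun x => ∑ j, L j x := by
  filter_upwards [ae_all_iff.2 fun j => (h j).weakDeriv_ae_eq] with x hx
  simp only [weakLaplacian, hx]

/-- The operator `Δ + τ` applied to the bulk corrector `χ(x/ε) G(x)`. -/
lemma shiftedLaplacian_osc_mul (hD : Bornology.IsBounded (D : Set (Space d))) (hε : 0 < ε)
    {f G : Space d → ℝ} (hf : MemHper2 f) (hG : MemH D 2 G) :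
    shiftedLaplacian D τ (fun x => osc ε f x * G x) =ᵐ[volOn D] fun x =>
      osc ε f x * shiftedLaplacian D τ G x +
      2 * ε⁻¹ * (∑ j, osc ε (weakDeriv ⊤ ![j] f) x * weakDeriv D ![j] G x) +
      ε⁻¹ ^ 2 * (osc ε (weakLaplacian ⊤ f) x * G x) := by
  filter_upwards [weakLaplacian_of_hasWeakDeriv fun j => hasWeakDeriv_osc_mul hD hε hf hG j]
    with x hx
  rw [shiftedLaplacian, hx, shiftedLaplacian]
  simp only [Finset.sum_add_distrib, osc, weakLaplacian, Finset.mul_sum, Finset.sum_mul, mul_add]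
  ring

/-- The operator `Δ + τ` applied to the bulk corrector `γ(x/ε) · G(x)`. -/
lemma shiftedLaplacian_sum_osc_mul (hD : Bornology.IsBounded (D : Set (Space d))) (hε : 0 < ε)
    {f G : Fin d → Space d → ℝ} (hf : ∀ i, MemHper2 (f i)) (hG : ∀ i, MemH D 2 (G i)) :
    shiftedLaplacian D τ (fun x => ∑ i, osc ε (f i) x * G i x) =ᵐ[volOn D] fun x =>
      ∑ i, (osc ε (f i) x * shiftedLaplacian D τ (G i) x +
      2 * ε⁻¹ * (∑ j, osc ε (weakDeriv ⊤ ![j] (f i)) x * weakDeriv D ![j] (G i) x) +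
      ε⁻¹ ^ 2 * (osc ε (weakLaplacian ⊤ (f i)) x * G i x)) := by
  have h1 := weakLaplacian_of_hasWeakDeriv fun j => HasWeakDeriv.sum Finset.univ
    fun i _ => hasWeakDeriv_osc_mul hD hε (hf i) (hG i) j
  have h2 : ∀ᵐ x ∂volOn D, ∀ i, weakLaplacian D (fun x => osc ε (f i) x * G i x) x = _ :=
    ae_all_iff.2 fun i =>
      weakLaplacian_of_hasWeakDeriv fun j => hasWeakDeriv_osc_mul hD hε (hf i) (hG i) j
  have h3 : ∀ᵐ x ∂volOn D, ∀ i, shiftedLaplacian D τ (fun x => osc ε (f i) x * G i x) x = _ :=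
    ae_all_iff.2 fun i => shiftedLaplacian_osc_mul hD hε (hf i) (hG i)
  filter_upwards [h1, h2, h3] with x e1 e2 e3
  rw [Finset.sum_congr rfl fun i _ => (e3 i).symm]
  simp only [shiftedLaplacian]
  rw [Finset.sum_add_distrib, Finset.sum_congr rfl fun i _ => e2 i, e1, Finset.sum_comm,
    Finset.mul_sum]

lemma integral_sub_sub_sub_mul {α : Type*} [MeasurableSpace α] {μ : Measure α}
    {f₁ f₂ f₃ f₄ p : α → ℝ} (h₁ : MemLp f₁ 2 μ) (h₂ : MemLp f₂ 2 μ) (h₃ : MemLp f₃ 2 μ)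
    (h₄ : MemLp f₄ 2 μ) (hp : MemLp p 2 μ) (c₃ c₄ : ℝ) :
    ∫ x, (f₁ x - f₂ x - c₃ * f₃ x - c₄ * f₄ x) * p x ∂μ =
      (∫ x, f₁ x * p x ∂μ) - (∫ x, f₂ x * p x ∂μ) - c₃ * (∫ x, f₃ x * p x ∂μ) -
        c₄ * ∫ x, f₄ x * p x ∂μ := by
  have i₁ := integrable_mul_of_memLp_two h₁ hp
  have i₂ := integrable_mul_of_memLp_two h₂ hp
  have i₃ := (integrable_mul_of_memLp_two h₃ hp).const_mul c₃
  have i₄ := (integrable_mul_of_memLp_two h₄ hp).const_mul c₄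
  have i₁₂ : Integrable (fun x => f₁ x * p x - f₂ x * p x) μ := i₁.sub i₂
  have i₁₂₃ : Integrable (fun x => f₁ x * p x - f₂ x * p x - c₃ * (f₃ x * p x)) μ := i₁₂.sub i₃
  rw [← integral_const_mul, ← integral_const_mul, ← integral_sub i₁ i₂, ← integral_sub i₁₂ i₃,
    ← integral_sub i₁₂₃ i₄]
  exact integral_congr_ae (ae_of_all _ fun x => by ring)

lemma IsWeakSol.integral_testLap {b u : Space d → ℝ} {h : 𝓓'(D, ℝ)} (hu : IsWeakSol D τ b h u)
    (φ : 𝓓(D, ℝ)) : (∫ x in (D : Set (Space d)), b x * shiftedLaplacian D τ u x *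
      (testLap φ x + τ * φ x)) + τ ^ 2 * (∫ x in (D : Set (Space d)), u x * φ x) = h φ := by
  have := hu.2 φ
  simpa only [laplacian_eq_testLap] using this

lemma exists_ae_bound {a : Space d → ℝ} (ha : MemLp a ⊤ volume) :
    ∃ M, 0 ≤ M ∧ ∀ᵐ y, |a y| ≤ M := by
  refine ⟨(eLpNorm a ⊤ volume).toReal, ENNReal.toReal_nonneg, ?_⟩
  have h := ha.2
  rw [eLpNorm_exponent_top] at h ⊢
  filter_upwards [ae_le_eLpNormEssSup (f := a) (μ := volume)] with y hy
  have := ENNReal.toReal_mono h.ne hy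
  simpa using this

variable {a χ u₀ uε θ₂ θ₃ : Space d → ℝ} {γ : Fin d → Space d → ℝ}

/-- The residual of the two-scale expansion, up to the factor `-ε² a(x/ε)`. -/
def residual (D : Opens (Space d)) (τ ε : ℝ) (χ : Space d → ℝ) (γ : Fin d → Space d → ℝ)
    (g : Space d → ℝ) (x : Space d) : ℝ :=
  osc ε χ x * shiftedLaplacian D τ g x +
    ∑ i, (ε * (osc ε (γ i) x * shiftedLaplacian D τ (weakDeriv D ![i] g) x) +
      2 * ∑ j, osc ε (weakDeriv ⊤ ![j] (γ i)) x * weakDeriv D ![j] (weakDeriv D ![i] g) x)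

/-- The terms of order `1` and `ε` of the expansion cancel. -/
lemma expansion_cancel (hD : Bornology.IsBounded (D : Set (Space d))) (hε : 0 < ε)
    {g : Space d → ℝ} {N : ℝ} (hg : MemHB D 3 g N) {a₀ : ℝ} (ha₀ : 0 < a₀)
    (ha : ∀ᵐ y, a₀ ≤ a y) (hχ : IsCellChi a χ) (hγ : IsCellGamma χ γ) :
    ∀ᵐ x ∂volOn D, homCoeff a * g x - osc ε a x * (g x +
      ε ^ 2 * shiftedLaplacian D τ (fun x => osc ε χ x * g x) x +
      ε ^ 3 * shiftedLaplacian D τ (fun x => ∑ i, osc ε (γ i) x * weakDeriv D ![i] g x) x) =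
      -ε ^ 2 * (osc ε a x * residual D τ ε χ γ g x) := by
  have hqm := quasiMeasurePreserving_smul (d := d) (inv_ne_zero hε.ne')
  have c1 : ∀ᵐ x : Space d, osc ε (weakLaplacian ⊤ χ) x = homCoeff a / osc ε a x - 1 :=
    hqm.ae hχ.2.2
  have c2 : ∀ᵐ x : Space d, ∀ i, -osc ε (weakLaplacian ⊤ (γ i)) x =
      2 * osc ε (weakDeriv ⊤ ![i] χ) x := ae_all_iff.2 fun i => hqm.ae (hγ i).2.2
  have c3 : ∀ᵐ x : Space d, a₀ ≤ osc ε a x := hqm.ae ha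
  have s1 := shiftedLaplacian_osc_mul (τ := τ) hD hε hχ.1 (hg.mono (by norm_num : 2 ≤ 3)).memH
  have s2 := shiftedLaplacian_sum_osc_mul (τ := τ) hD hε (fun i => (hγ i).1)
    fun i => (hg.deriv (k := 2) i).memH
  filter_upwards [ae_restrict_of_ae c1, ae_restrict_of_ae c2, ae_restrict_of_ae c3, s1, s2]
    with x h1 h2 h3 h4 h5
  -- Order 1: the factor g(1 + Δχ) equals g ā/a. Order ε: 2∇χ·∇g from the first corrector meets
  -- Δγ·∇g = -2∇χ·∇g from the second. The rest carries ε².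
  rw [h4, h5, h1, residual]
  have h2' : ∀ i, osc ε (weakLaplacian ⊤ (γ i)) x = -(2 * osc ε (weakDeriv ⊤ ![i] χ) x) :=
    fun i => by rw [← h2 i, neg_neg]
  have hpos : osc ε a x ≠ 0 := (ha₀.trans_le h3).ne'
  simp only [h2', Finset.sum_add_distrib, ← Finset.mul_sum]
  have e1 : ∑ i, -(2 * osc ε (weakDeriv ⊤ ![i] χ) x) * weakDeriv D ![i] g x =
      -2 * ∑ i, osc ε (weakDeriv ⊤ ![i] χ) x * weakDeriv D ![i] g x := by
    rw [Finset.mul_sum]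
    exact Finset.sum_congr rfl fun i _ => by ring
  rw [e1]
  field_simp
  ring

/-- The oscillating factors enter only through their sup bounds, which rescaling does not change;
hence a bound free of ε. The worst term is Δ + τ applied to ∇g, which uses all three derivatives of
g. -/
lemma l2norm_residual_le {g : Space d → ℝ} {N M : ℝ} (hτ : 0 ≤ τ) (hε : 0 < ε) (hε1 : ε ≤ 1)
    (hM : 0 ≤ M) (hg : MemHB D 3 g N) (hχm : AEStronglyMeasurable χ volume)
    (hγm : ∀ i, AEStronglyMeasurable (γ i) volume)
    (hγm' : ∀ i j, AEStronglyMeasurable (weakDeriv ⊤ ![j] (γ i)) volume)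
    (bχ : ∀ᵐ y, |χ y| ≤ M) (bγ : ∀ i, ∀ᵐ y, |γ i y| ≤ M)
    (bγ' : ∀ i j, ∀ᵐ y, |weakDeriv ⊤ ![j] (γ i) y| ≤ M) :
    MemLp (residual D τ ε χ γ g) 2 (volOn D) ∧ l2norm (volOn D) (residual D τ ε χ γ g) ≤
      M * ((d + τ) * N) + d * (M * ((d + τ) * N) + 2 * (d * (M * N))) := by
  have gen : ∀ {F H : Space d → ℝ} {K : ℝ}, AEStronglyMeasurable F volume →
      (∀ᵐ y, |F y| ≤ M) → MemHB D 0 H K → MemLp (fun x => osc ε F x * H x) 2 (volOn D) ∧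
      l2norm (volOn D) (fun x => osc ε F x * H x) ≤ M * K := by
    intro F H K hF hb hH
    have hb' : ∀ᵐ x ∂volOn D, |osc ε F x| ≤ M :=
      ae_restrict_of_ae (ae_osc (p := fun t => |t| ≤ M) hε hb)
    exact ⟨memLp_bdd_mul (aestronglyMeasurable_osc hε hF).restrict hb' hH.memLp.1,
      (l2norm_mul_le hM hb' hH.memLp.1).trans (mul_le_mul_of_nonneg_left hH.memLp.2 hM)⟩
  obtain ⟨m1, n1⟩ := gen hχm bχ ((MemHB.shiftedLaplacian (k := 1) hτ hg).mono zero_le_one)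
  have p2 := fun i => gen (hγm i) (bγ i)
    (MemHB.shiftedLaplacian (k := 0) hτ (hg.deriv (k := 2) i))
  have p3 := fun i j => gen (hγm' i j) (bγ' i j)
    (((hg.deriv (k := 2) i).deriv (k := 1) j).mono zero_le_one)
  have m2 : ∀ i, MemLp (fun x => ε * (osc ε (γ i) x *
      shiftedLaplacian D τ (weakDeriv D ![i] g) x)) 2 (volOn D) := fun i => (p2 i).1.const_mul ε
  have m3 : ∀ i, MemLp (fun x => ∑ j, osc ε (weakDeriv ⊤ ![j] (γ i)) x *
      weakDeriv D ![j] (weakDeriv D ![i] g) x) 2 (volOn D) := fun i =>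
    memLp_finsetSum _ fun j _ => (p3 i j).1
  have n2 : ∀ i, l2norm (volOn D) (fun x => ε * (osc ε (γ i) x *
      shiftedLaplacian D τ (weakDeriv D ![i] g) x)) ≤ M * ((d + τ) * N) := fun i => by
    rw [l2norm_const_mul, abs_of_pos hε]
    exact (mul_le_of_le_one_left (l2norm_nonneg _) hε1).trans (p2 i).2
  have n3 : ∀ i, l2norm (volOn D) (fun x => 2 * ∑ j, osc ε (weakDeriv ⊤ ![j] (γ i)) x *
      weakDeriv D ![j] (weakDeriv D ![i] g) x) ≤ 2 * (d * (M * N)) := fun i => by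
    rw [l2norm_const_mul, abs_two]
    refine mul_le_mul_of_nonneg_left ?_ zero_le_two
    refine (l2norm_sum_le _ fun j _ => (p3 i j).1).trans ?_
    refine (Finset.sum_le_sum fun j _ => (p3 i j).2).trans_eq ?_
    simp
  have m4 := fun i => (m2 i).add ((m3 i).const_mul 2)
  have m5 := memLp_finsetSum Finset.univ fun i _ => m4 i
  refine ⟨m1.add m5, (l2norm_add_le m1 m5).trans (add_le_add n1 ?_)⟩
  refine (l2norm_sum_le _ fun i _ => m4 i).trans ?_
  refine (Finset.sum_le_sum fun i _ => (l2norm_add_le (m2 i) ((m3 i).const_mul 2)).trans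
    (add_le_add (n2 i) (n3 i))).trans_eq ?_
  simp only [Finset.sum_const, Finset.card_univ, Fintype.card_fin, nsmul_eq_mul]

lemma l2norm_bulk_le {g : Space d → ℝ} {N M : ℝ} (hε : 0 < ε)
    (hM : 0 ≤ M) (hg : MemHB D 3 g N)
    (hγm : ∀ i, AEStronglyMeasurable (γ i) volume)
    (bχ : ∀ᵐ y, |χ y| ≤ M) (bγ : ∀ i, ∀ᵐ y, |γ i y| ≤ M) :
    l2norm (volOn D) (fun x => osc ε χ x * g x) ≤ M * N ∧
      l2norm (volOn D) (fun x => ∑ i, osc ε (γ i) x * weakDeriv D ![i] g x) ≤ d * (M * N) := by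
  have b' : ∀ {F : Space d → ℝ}, (∀ᵐ y, |F y| ≤ M) → ∀ᵐ x ∂volOn D, |osc ε F x| ≤ M :=
    fun hb => ae_restrict_of_ae (ae_osc (p := fun t => |t| ≤ M) hε hb)
  have g' := fun i => (hg.deriv (k := 2) i).memLp
  refine ⟨(l2norm_mul_le hM (b' bχ) hg.memLp.1).trans
    (mul_le_mul_of_nonneg_left hg.memLp.2 hM), ?_⟩
  refine (l2norm_sum_le _ fun i _ => memLp_bdd_mul (aestronglyMeasurable_osc hε (hγm i)).restrict
    (b' (bγ i)) (g' i).1).trans ?_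
  refine (Finset.sum_le_sum fun i _ => (l2norm_mul_le hM (b' (bγ i)) (g' i).1).trans
    (mul_le_mul_of_nonneg_left (g' i).2 hM)).trans_eq ?_
  simp

end Expansion


/-! ### The remainder and its weak equation. -/

section Main

variable {d : ℕ} {D : Opens (Space d)} {ε τ : ℝ} {a χ u₀ uε θ₂ θ₃ : Space d → ℝ}
  {γ : Fin d → Space d → ℝ}

/-- Both θ and θ + εv are in H²(D), so v is too. This yields H² regularity of the bulk correctors
without estimating products such as ∇χ·∇g. -/
lemma IsBoundaryCorrector.memH {v θ : Space d → ℝ} (hε : 0 < ε)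
    (h : IsBoundaryCorrector D τ ε a v θ) : MemH D 2 v := by
  have := (h.2.1.sub h.1.1).const_mul ε⁻¹
  convert this using 2 with x
  field_simp
  ring

/-- The remainder of the expansion. -/
def remainder (D : Opens (Space d)) (τ ε : ℝ) (χ : Space d → ℝ) (γ : Fin d → Space d → ℝ)
    (uε u₀ θ₂ θ₃ : Space d → ℝ) (x : Space d) : ℝ :=
  uε x - (u₀ x + ε ^ 2 * bulk2 D τ ε χ u₀ x + ε * θ₂ x + ε ^ 3 * bulk3 D τ ε γ u₀ x +
    ε ^ 2 * θ₃ x)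

/-- Each bulk term is paired with its corrector: the combinations θ + εv, weighted by ε and ε², are
in H²₀(D). -/
lemma memH20_remainder (huε : MemH20 D uε) (hu₀ : MemH20 D u₀)
    (hθ₂ : IsBoundaryCorrector D τ ε a (bulk2 D τ ε χ u₀) θ₂)
    (hθ₃ : IsBoundaryCorrector D τ ε a (bulk3 D τ ε γ u₀) θ₃) :
    MemH20 D (remainder D τ ε χ γ uε u₀ θ₂ θ₃) := by
  have := ((huε.add (hu₀.const_mul (-1))).add (hθ₂.2.const_mul (-ε))).add
    (hθ₃.2.const_mul (-ε ^ 2))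
  convert this using 2 with x
  rw [remainder]
  ring

lemma shiftedLaplacian_remainder (hε : 0 < ε) (huε : MemH D 2 uε) (hu₀ : MemH D 2 u₀)
    (hθ₂ : IsBoundaryCorrector D τ ε a (bulk2 D τ ε χ u₀) θ₂)
    (hθ₃ : IsBoundaryCorrector D τ ε a (bulk3 D τ ε γ u₀) θ₃) :
    shiftedLaplacian D τ (remainder D τ ε χ γ uε u₀ θ₂ θ₃) =ᵐ[volOn D] fun x =>
      shiftedLaplacian D τ uε x - (shiftedLaplacian D τ u₀ x +
        ε ^ 2 * shiftedLaplacian D τ (bulk2 D τ ε χ u₀) x + ε * shiftedLaplacian D τ θ₂ x +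
        ε ^ 3 * shiftedLaplacian D τ (bulk3 D τ ε γ u₀) x + ε ^ 2 * shiftedLaplacian D τ θ₃ x) := by
  have m2 := (hθ₂.memH hε).const_mul (ε ^ 2)
  have m3 := (hθ₃.memH hε).const_mul (ε ^ 3)
  have t2 := hθ₂.1.1.const_mul ε
  have t3 := hθ₃.1.1.const_mul (ε ^ 2)
  have s1 := hu₀.add m2
  have s2 := s1.add t2
  have s3 := s2.add m3
  have s4 := s3.add t3
  filter_upwards [shiftedLaplacian_sub (τ := τ) huε s4, shiftedLaplacian_add (τ := τ) s3 t3,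
    shiftedLaplacian_add (τ := τ) s2 m3, shiftedLaplacian_add (τ := τ) s1 t2,
    shiftedLaplacian_add (τ := τ) hu₀ m2,
    shiftedLaplacian_const_mul (τ := τ) (ε ^ 2) (hθ₂.memH hε),
    shiftedLaplacian_const_mul (τ := τ) (ε ^ 3) (hθ₃.memH hε),
    shiftedLaplacian_const_mul (τ := τ) ε hθ₂.1.1,
    shiftedLaplacian_const_mul (τ := τ) (ε ^ 2) hθ₃.1.1] with x h1 h2 h3 h4 h5 h6 h7 h8 h9
  exact h1.trans (by rw [h2, h3, h4, h5, h6, h7, h8, h9])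

/-- The remainder solves the fourth-order problem with a small right-hand side. -/
lemma energy_identity_remainder (hD : Bornology.IsBounded (D : Set (Space d))) (hτ : 0 ≤ τ)
    (hε : 0 < ε) {h : 𝓓'(D, ℝ)} {N M a₀ : ℝ} (hN : MemHB D 3 (shiftedLaplacian D τ u₀) N)
    (ha₀ : 0 < a₀) (ha : ∀ᵐ y, a₀ ≤ a y) (ham : AEStronglyMeasurable a volume)
    (haM : ∀ᵐ y, |a y| ≤ M) (hχ : IsCellChi a χ) (hγ : IsCellGamma χ γ)
    (huε : IsWeakSol D τ (osc ε a) h uε) (hu₀ : IsWeakSol D τ (fun _ => homCoeff a) h u₀)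
    (hθ₂ : IsBoundaryCorrector D τ ε a (bulk2 D τ ε χ u₀) θ₂)
    (hθ₃ : IsBoundaryCorrector D τ ε a (bulk3 D τ ε γ u₀) θ₃) (φ : 𝓓(D, ℝ)) :
    (∫ x in (D : Set (Space d)),
      (osc ε a x * shiftedLaplacian D τ (remainder D τ ε χ γ uε u₀ θ₂ θ₃) x -
        -ε ^ 2 * (osc ε a x * residual D τ ε χ γ (shiftedLaplacian D τ u₀) x)) *
        (testLap φ x + τ * φ x)) +
      ∫ x in (D : Set (Space d)), (τ ^ 2 * remainder D τ ε χ γ uε u₀ θ₂ θ₃ x -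
        -τ ^ 2 * (ε ^ 2 * bulk2 D τ ε χ u₀ x + ε ^ 3 * bulk3 D τ ε γ u₀ x)) * φ x = 0 := by
  have hb : ∀ᵐ x ∂volOn D, |osc ε a x| ≤ M :=
    ae_restrict_of_ae (ae_osc (p := fun t => |t| ≤ M) hε haM)
  have hbm : AEStronglyMeasurable (osc ε a) (volOn D) := (aestronglyMeasurable_osc hε ham).restrict
  have hp : MemLp (fun x => testLap φ x + τ * φ x) 2 (volOn D) :=
    (memLp_test _).add ((memLp_test φ).const_mul τ)
  have hm : ∀ {u : Space d → ℝ}, MemH D 2 u →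
      MemLp (fun x => osc ε a x * shiftedLaplacian D τ u x) 2 (volOn D) := fun hu =>
    memLp_bdd_mul hbm hb (hu.memLp_shiftedLaplacian hτ)
  have e1 : ∀ᵐ x ∂volOn D,
      osc ε a x * shiftedLaplacian D τ (remainder D τ ε χ γ uε u₀ θ₂ θ₃) x -
        -ε ^ 2 * (osc ε a x * residual D τ ε χ γ (shiftedLaplacian D τ u₀) x) =
      osc ε a x * shiftedLaplacian D τ uε x - homCoeff a * shiftedLaplacian D τ u₀ x -
        ε * (osc ε a x * shiftedLaplacian D τ θ₂ x) -
        ε ^ 2 * (osc ε a x * shiftedLaplacian D τ θ₃ x) := by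
    filter_upwards [shiftedLaplacian_remainder hε huε.1 hu₀.1 hθ₂ hθ₃,
      expansion_cancel (τ := τ) hD hε hN ha₀ ha hχ hγ] with x h1 h2
    rw [h1, ← h2]
    unfold bulk2 bulk3
    ring
  -- Subtracting the source removes the bulk terms and leaves the same combination of u_ε, u₀ and
  -- the two correctors as in the principal part, so the four weak equations can be combined.
  have e2 : ∀ x, τ ^ 2 * remainder D τ ε χ γ uε u₀ θ₂ θ₃ x -
        -τ ^ 2 * (ε ^ 2 * bulk2 D τ ε χ u₀ x + ε ^ 3 * bulk3 D τ ε γ u₀ x) =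
      τ ^ 2 * (uε x - u₀ x - ε * θ₂ x - ε ^ 2 * θ₃ x) := fun x => by
    rw [remainder]
    ring
  have i1 : ∫ x in (D : Set (Space d)),
      (osc ε a x * shiftedLaplacian D τ (remainder D τ ε χ γ uε u₀ θ₂ θ₃) x -
        -ε ^ 2 * (osc ε a x * residual D τ ε χ γ (shiftedLaplacian D τ u₀) x)) *
        (testLap φ x + τ * φ x) = _ :=
    (integral_congr_ae (by filter_upwards [e1] with x hx; rw [hx])).trans
      (integral_sub_sub_sub_mul (hm huε.1)
        ((hu₀.1.memLp_shiftedLaplacian hτ).const_mul (homCoeff a)) (hm hθ₂.1.1) (hm hθ₃.1.1) hp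
        ε (ε ^ 2))
  have i2 : ∫ x in (D : Set (Space d)), (τ ^ 2 * remainder D τ ε χ γ uε u₀ θ₂ θ₃ x -
        -τ ^ 2 * (ε ^ 2 * bulk2 D τ ε χ u₀ x + ε ^ 3 * bulk3 D τ ε γ u₀ x)) * φ x =
      τ ^ 2 * ∫ x in (D : Set (Space d)), (uε x - u₀ x - ε * θ₂ x - ε ^ 2 * θ₃ x) * φ x := by
    rw [← integral_const_mul]
    exact integral_congr_ae (ae_of_all _ fun x => by simp only [e2]; ring)
  rw [i1, i2, integral_sub_sub_sub_mul huε.1.memLp hu₀.1.memLp hθ₂.1.1.memLp hθ₃.1.1.memLp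
    (memLp_test φ) ε (ε ^ 2)]
  have w1 := huε.integral_testLap φ
  have w2 := hu₀.integral_testLap φ
  have w3 := hθ₂.1.integral_testLap φ
  have w4 := hθ₃.1.integral_testLap φ
  have z : (0 : 𝓓'(D, ℝ)) φ = 0 := rfl
  rw [z] at w3 w4
  -- The common right-hand side h cancels between u_ε and u₀; the correctors have right-hand side
  -- zero.
  linear_combination w1 - w2 - ε * w3 - ε ^ 2 * w4

end Main

end Homog
end

theorem mainTheorem3 (d : ℕ) (hd : d = 2 ∨ d = 3)
    (D : TopologicalSpace.Opens (Homog.Space d))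
    (hDbdd : Bornology.IsBounded (D : Set (Homog.Space d)))
    (hDconn : IsConnected (D : Set (Homog.Space d)))
    (hDbdry : Homog.HasC2Boundary D)
    (τ : ℝ) (hτ : 0 < τ)
    (a : Homog.Space d → ℝ) (haL : MemLp a ⊤ volume) (haper : Homog.IsPeriodic a)
    (a₀ : ℝ) (ha₀ : 0 < a₀) (hapos : ∀ᵐ y : Homog.Space d, a₀ ≤ a y)
    (χ : Homog.Space d → ℝ) (hχ : Homog.IsCellChi a χ)
    (γ : Fin d → Homog.Space d → ℝ) (hγ : Homog.IsCellGamma χ γ) :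
    ∃ C : ℝ, 0 < C ∧
      ∀ ε : ℝ, 0 < ε → ε ≤ 1 →
      ∀ h : 𝓓'(D, ℝ),
      ∀ uε u₀ θ₂ θ₃ : Homog.Space d → ℝ,
        Homog.MemH20 D uε → Homog.IsWeakSol D τ (Homog.osc ε a) h uε →
        Homog.MemH20 D u₀ → Homog.IsWeakSol D τ (fun _ => Homog.homCoeff a) h u₀ →
        Homog.MemH D 5 u₀ →
        Homog.IsBoundaryCorrector D τ ε a (Homog.bulk2 D τ ε χ u₀) θ₂ →
        Homog.IsBoundaryCorrector D τ ε a (Homog.bulk3 D τ ε γ u₀) θ₃ →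
        Homog.MemH20 D (fun x => uε x - (u₀ x + ε ^ 2 * Homog.bulk2 D τ ε χ u₀ x + ε * θ₂ x
            + ε ^ 3 * Homog.bulk3 D τ ε γ u₀ x + ε ^ 2 * θ₃ x)) ∧
        Homog.normH20 D (fun x => uε x - (u₀ x + ε ^ 2 * Homog.bulk2 D τ ε χ u₀ x + ε * θ₂ x
            + ε ^ 3 * Homog.bulk3 D τ ε γ u₀ x + ε ^ 2 * θ₃ x))
          ≤ C * ε ^ 2 * Homog.normH D 5 u₀ := by
  open Homog in
  obtain ⟨Ma, hMa, haM⟩ := exists_ae_bound haL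
  obtain ⟨M, hM, bχ, bγ, bγ'⟩ := exists_cell_bound (by omega : d < 4) hχ hγ
  have hχm : AEStronglyMeasurable χ volume :=
    (locallyIntegrable_of_top (hχ.1.weakDeriv zero_le_two ![]).1.1).aestronglyMeasurable
  have hγm : ∀ i, AEStronglyMeasurable (γ i) volume := fun i =>
    (locallyIntegrable_of_top ((hγ i).1.weakDeriv zero_le_two ![]).1.1).aestronglyMeasurable
  have hγm' : ∀ i j, AEStronglyMeasurable (weakDeriv ⊤ ![j] (γ i)) volume := fun i j =>
    (locallyIntegrable_of_top
      ((hγ i).1.weakDeriv one_le_two ![j]).1.2.1).aestronglyMeasurable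
  -- The loss in passing from derivatives of u₀ up to order five to those of g = (Δ + τ)u₀ up to
  -- order three.
  set c : ℝ := d + τ with hc
  have hc0 : 0 < c := by positivity
  set E : ℝ := 2 * (1 + τ) / min a₀ (τ ^ 2) with hE
  have hE0 : 0 < E := div_pos (by positivity) (lt_min ha₀ (by positivity))
  -- `Q` and `B` are the bounds for the residual and for the two bulk correctors, with g measured by
  -- c times the H⁵ norm of u₀ and that norm factored out.
  set Q : ℝ := M * (c * c) + d * (M * (c * c) + 2 * (d * (M * c))) with hQ
  set B : ℝ := M * c + d * (M * c) with hB
  have hQ0 : 0 ≤ Q := by positivity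
  have hB0 : 0 ≤ B := by positivity
  -- The added 1 only makes the constant strictly positive.
  refine ⟨E * (Ma * Q + τ ^ 2 * B) + 1, by positivity, ?_⟩
  intro ε hε hε1 h uε u₀ θ₂ θ₃ huε suε hu₀ su₀ hu₅ hθ₂ hθ₃
  have hr := memH20_remainder huε hu₀ hθ₂ hθ₃
  refine ⟨hr, ?_⟩
  change normH20 D (remainder D τ ε χ γ uε u₀ θ₂ θ₃) ≤ _
  set N := normH D 5 u₀ with hNdef
  have hN0 : 0 ≤ N := normH_nonneg
  have hg : MemHB D 3 (shiftedLaplacian D τ u₀) (c * N) :=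
    MemHB.shiftedLaplacian (k := 3) hτ.le hu₅.memHB
  obtain ⟨mR, nR⟩ := l2norm_residual_le hτ.le hε hε1 hM hg hχm hγm hγm' bχ bγ bγ'
  obtain ⟨n2, n3⟩ := l2norm_bulk_le hε hM hg hγm bχ bγ
  have hb : ∀ᵐ x ∂volOn D, |osc ε a x| ≤ Ma :=
    ae_restrict_of_ae (ae_osc (p := fun t => |t| ≤ Ma) hε haM)
  have hb₀ : ∀ᵐ x ∂volOn D, a₀ ≤ osc ε a x :=
    ae_restrict_of_ae (ae_osc (p := fun t => a₀ ≤ t) hε hapos)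
  have hbm : AEStronglyMeasurable (osc ε a) (volOn D) :=
    (aestronglyMeasurable_osc hε haL.1).restrict
  have m2 := (hθ₂.memH hε).memLp.const_mul (ε ^ 2)
  have m3 := (hθ₃.memH hε).memLp.const_mul (ε ^ 3)
  have key := energy_estimate hτ ha₀ hr hbm hb₀ hb
    ((memLp_bdd_mul hbm hb mR).const_mul (-ε ^ 2)) ((m2.add m3).const_mul (-τ ^ 2))
    (energy_identity_remainder hDbdd hτ.le hε hg ha₀ hapos haL.1 haM hχ hγ suε su₀ hθ₂ hθ₃)
  refine key.trans ?_
  rw [l2norm_const_mul, l2norm_const_mul, abs_neg, abs_neg, abs_of_nonneg (sq_nonneg ε),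
    abs_of_nonneg (sq_nonneg τ)]
  have hR : l2norm (volOn D) (fun x => osc ε a x * residual D τ ε χ γ (shiftedLaplacian D τ u₀) x)
      ≤ Ma * (Q * N) := by
    refine (l2norm_mul_le hMa hb mR).trans (mul_le_mul_of_nonneg_left (nR.trans_eq ?_) hMa)
    rw [hQ]
    ring
  have hS : l2norm (volOn D) ((fun x => ε ^ 2 * bulk2 D τ ε χ u₀ x) +
      fun x => ε ^ 3 * bulk3 D τ ε γ u₀ x) ≤ ε ^ 2 * (B * N) := by
    refine (l2norm_add_le m2 m3).trans ?_
    rw [l2norm_const_mul, l2norm_const_mul, abs_of_pos (by positivity), abs_of_pos (by positivity)]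
    have h3 : ε ^ 3 ≤ ε ^ 2 := pow_le_pow_of_le_one hε.le hε1 (by norm_num)
    have n2' : l2norm (volOn D) (bulk2 D τ ε χ u₀) ≤ M * (c * N) := n2
    have n3' : l2norm (volOn D) (bulk3 D τ ε γ u₀) ≤ d * (M * (c * N)) := n3
    have h4 := mul_le_mul h3 n3' (l2norm_nonneg _) (sq_nonneg ε)
    have h5 := mul_le_mul_of_nonneg_left n2' (sq_nonneg ε)
    rw [hB]
    linarith
  calc E * (ε ^ 2 * _ + τ ^ 2 * _) ≤ E * (ε ^ 2 * (Ma * (Q * N)) + τ ^ 2 * (ε ^ 2 * (B * N))) :=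
        mul_le_mul_of_nonneg_left (add_le_add (mul_le_mul_of_nonneg_left hR (sq_nonneg ε))
          (mul_le_mul_of_nonneg_left hS (sq_nonneg τ))) hE0.le
    _ = E * (Ma * Q + τ ^ 2 * B) * (ε ^ 2 * N) := by ring
    _ ≤ (E * (Ma * Q + τ ^ 2 * B) + 1) * (ε ^ 2 * N) :=
        mul_le_mul_of_nonneg_right (by linarith) (by positivity)
    _ = _ := by ring
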